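/- Let $V:\mathbb R\to\mathbb R$ be a smooth even function such that (A) there are $k\ge 2$ and $a>0$ with $\lambda^{-k}V(\lambda x)\to a|x|^k$ and $\lambda^{1-k}V'(\lambda x)\to k\,a\,|x|^{k-1}\operatorname{sign}(x)$ as $\lambda\to+\infty$, for every $x\in\mathbb R$; and (B) for every $q\in\mathbb R$ there is $m\ge 2$ with $V^{(m)}(q)\ne 0$. Let $\tau\in\mathbb R$, $T>0$, $\gamma>0$. Let $\mu=\mu_{\tau,T}$ be the product probability measure on configurations $\omega=(r_x,p_x)_{x\in\mathbb Z}$ under which all the $r_x,p_x$ are independent, $p_x$ is a centered Gaussian of variance $T$, and $r_x$ has density proportional to $e^{-(V(r)-\tau r)/T}$. Let $\theta_x$ denote the shift, $(\theta_x\omega)_z=\omega_{x+z}$ and $(\theta_x g)(\omega)=g(\theta_x\omega)$. Let $\mathcal H$ be the Hilbert space obtained by completing the space of local (i.e. depending on finitely many sites) $\mu$-square-integrable functions with respect to the semi-inner product $$\ll f,g\gg\;=\;\sum_{x\in\mathbb Z}\{\mu(f\,\theta_x g)-\mu(f)\mu(g)\}.$$ For compactly supported local $C^1$ functions $f$ (compactly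 supported $C^1$ functions of the coordinates at finitely many sites) put $$\mathfrak L f=\sum_{x\in\mathbb Z}\big[(p_x-p_{x-1})\partial_{r_x}f+(V'(r_{x+1})-V'(r_x))\partial_{p_x}f\big]+\gamma\sum_{x\in\mathbb Z}\big[f(\omega^x)-f(\omega)\big],$$ where $\omega^x$ is $\omega$ with $p_x$ replaced by $-p_x$. Assume that the closure in $\mathcal H$ of this operator (defined on the linear span of such functions), again denoted by $\mathfrak L$, is the generator of a strongly continuous semigroup on $\mathcal H$. Let $j_{0,1}=-p_0V'(r_1)$. Then for every $\lambda>0$ the operator $\lambda-\mathfrak L$ is a bijection from its domain onto $\mathcal H$, and, writing $\sigma(f,g)=\lim_{\lambda\downarrow 0}\ll f,(\lambda-\mathfrak L)^{-1}g\gg$, the two limits below exist and $$\sigma(j_{0,1}+\tau p_0,\,p_0)=\sigma(p_0,\,j_{0,1}+\tau p_0)=0 .$$ Hence the off-diagonal transport coefficients $\kappa^{e,r}=-T^{-1}\sigma(p_0,\,j_{0,1}+\tau p_0)$ and $\kappa^{r,e}=-T^{-2}\sigma(j_{0,1}+\tau p_0,\,p_0)$ vanish. -/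

import Mathlib

open MeasureTheory ProbabilityTheory Filter Topology
open scoped NNReal ENNReal

noncomputable section

/-- The standing assumptions on the interaction potential: smooth, even, polynomially growing of
some degree `k ≥ 2` (together with its derivative), and nowhere flat to infinite order. -/
structure IsAnharmonicPotential (V : ℝ → ℝ) : Prop where
  smooth : ContDiff ℝ (⊤ : ℕ∞) V
  even : ∀ r, V (-r) = V r
  growth : ∃ k a : ℝ, 2 ≤ k ∧ 0 < a ∧
    (∀ x : ℝ, Tendsto (fun l : ℝ => l ^ (-k) * V (l * x)) atTop (𝓝 (a * |x| ^ k))) ∧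
    (∀ x : ℝ, Tendsto (fun l : ℝ => l ^ (1 - k) * deriv V (l * x)) atTop
      (𝓝 (k * a * |x| ^ (k - 1) * Real.sign x)))
  nondegenerate : ∀ q : ℝ, ∃ m : ℕ, 2 ≤ m ∧ iteratedDeriv m V q ≠ 0

/-- The parameters of the infinite chain: potential `V`, tension `τ`, temperature `T > 0` and
intensity `γ > 0` of the velocity flips. -/
structure OscillatorChain where
  V : ℝ → ℝ
  τ : ℝ
  T : ℝ
  γ : ℝ
  potential : IsAnharmonicPotential V
  T_pos : 0 < T
  γ_pos : 0 < γ

namespace OscillatorChain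

/-- A configuration `η`; `(η x).1 = r_x` is the interparticle distance and `(η x).2 = p_x` the
momentum at the site `x`. -/
abbrev Config : Type := ℤ → ℝ × ℝ

/-- The shift `θ_x`, `(θ_x η)_z = η_{x+z}`. -/
def shift (x : ℤ) (η : Config) : Config := fun z => η (x + z)

/-- `η^x`: the momentum at `x` changes sign. -/
def flip (x : ℤ) (η : Config) : Config := Function.update η x ((η x).1, -(η x).2)

/-- `∂_{r_x} f`. -/
def partialR (x : ℤ) (f : Config → ℝ) (η : Config) : ℝ :=
  deriv (fun s : ℝ => f (Function.update η x (s, (η x).2))) (η x).1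

/-- `∂_{p_x} f`. -/
def partialP (x : ℤ) (f : Config → ℝ) (η : Config) : ℝ :=
  deriv (fun s : ℝ => f (Function.update η x ((η x).1, s))) (η x).2

variable (M : OscillatorChain)

/-! ### The formal generator -/

/-- The Liouville operator on functions of the configuration. For a local function the sum has only
finitely many nonzero terms. -/
def liouville (f : Config → ℝ) (η : Config) : ℝ :=
  ∑ᶠ x : ℤ, (((η x).2 - (η (x - 1)).2) * partialR x f η
    + (deriv M.V (η (x + 1)).1 - deriv M.V (η x).1) * partialP x f η)

/-- The velocity flip noise. For a local function the sum has only finitely many nonzero terms. -/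
def noise (f : Config → ℝ) (η : Config) : ℝ := ∑ᶠ x : ℤ, (f (flip x η) - f η)

/-- The formal generator, Liouville operator plus `γ` times the noise. -/
def formalGenerator (f : Config → ℝ) (η : Config) : ℝ := M.liouville f η + M.γ * noise f η

/-- Compactly supported local functions of class `C¹`: compactly supported `C¹` functions of the
coordinates at finitely many sites. -/
def IsLocalTest (f : Config → ℝ) : Prop :=
  ∃ (Λ : Finset ℤ) (φ : (Λ → ℝ × ℝ) → ℝ), ContDiff ℝ 1 φ ∧ HasCompactSupport φ ∧
    ∀ η : Config, f η = φ (fun x => η x)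

/-! ### The Gibbs measure -/

/-- The law of one interparticle distance: density proportional to `exp (-(V(r) - τ r) / T)`. -/
def rLaw : Measure ℝ := volume.tilted (fun r => -(M.V r - M.τ * r) / M.T)

/-- The law at one site: independent distance and centered Gaussian momentum of variance `T`. -/
def siteLaw : Measure (ℝ × ℝ) := M.rLaw.prod (gaussianReal 0 M.T.toNNReal)

lemma continuous_deriv_V : Continuous (deriv M.V) :=
  M.potential.smooth.continuous_deriv (by norm_cast)

lemma deriv_V_neg (r : ℝ) : deriv M.V (-r) = - deriv M.V r := by
  have h : M.V = fun r => M.V (-r) := funext fun r => (M.potential.even r).symm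
  have h2 : deriv M.V r = deriv (fun r => M.V (-r)) r := by rw [← h]
  rw [h2, deriv_comp_neg]; ring

lemma exists_decay : ∃ a : ℝ, 0 < a ∧ ∀ᶠ l : ℝ in atTop,
    a * l ^ 2 ≤ M.V l ∧ |deriv M.V l| ≤ Real.exp l := by
  obtain ⟨k, a, hk, ha, h1, h2⟩ := M.potential.growth
  refine ⟨a / 2, by positivity, ?_⟩
  have h1' : Tendsto (fun l : ℝ => l ^ (-k) * M.V l) atTop (𝓝 a) := by
    simpa using h1 1
  have h2' : Tendsto (fun l : ℝ => l ^ (1 - k) * deriv M.V l) atTop (𝓝 (k * a)) := by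
    simpa using h2 1
  have e1 := h1'.eventually (lt_mem_nhds (show a / 2 < a by linarith))
  have e2 := h2'.abs.eventually (gt_mem_nhds (show |k * a| < |k * a| + 1 by linarith))
  have e3 : ∀ᶠ l : ℝ in atTop, (|k * a| + 1) * l ^ (k - 1) ≤ Real.exp l := by
    have h3 := (isLittleO_rpow_exp_pos_mul_atTop (k - 1) one_pos).def
      (show 0 < (|k * a| + 1)⁻¹ by positivity)
    filter_upwards [h3, eventually_gt_atTop 0] with l hl hl0
    rw [Real.norm_of_nonneg (by positivity), Real.norm_of_nonneg (by positivity), one_mul] at hl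
    have : (0 : ℝ) < |k * a| + 1 := by positivity
    rwa [← div_eq_inv_mul, le_div_iff₀' this] at hl
  filter_upwards [e1, e2, e3, eventually_ge_atTop 1] with l h1 h2 h3 hl
  have hl0 : 0 < l := by linarith
  constructor
  · have hk0 : (0 : ℝ) < l ^ k := by positivity
    rw [Real.rpow_neg hl0.le, ← div_eq_inv_mul, lt_div_iff₀ hk0] at h1
    have : l ^ 2 ≤ l ^ k := by
      have := Real.rpow_le_rpow_of_exponent_le hl hk
      simpa using this
    nlinarith
  · have hk0 : (0 : ℝ) < l ^ (k - 1) := by positivity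
    have h : (1 - k) = -(k - 1) := by ring
    rw [abs_mul, abs_of_nonneg (by positivity), h, Real.rpow_neg hl0.le, ← div_eq_inv_mul,
      div_lt_iff₀ hk0] at h2
    linarith

lemma integrable_deriv_pow (n : ℕ) :
    Integrable (fun r : ℝ => Real.exp (-(M.V r - M.τ * r) / M.T) * (deriv M.V r) ^ n) := by
  obtain ⟨a, ha, hd⟩ := M.exists_decay
  have hT := M.T_pos
  have key : ∀ s : ℝ, (fun l : ℝ => Real.exp (-(M.V l - s * l) / M.T) * (deriv M.V l) ^ n)
      =O[atTop] (fun l : ℝ => Real.exp (-(a / (2 * M.T)) * l ^ 2)) := by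
    intro s
    refine Asymptotics.IsBigO.of_bound 1 ?_
    filter_upwards [hd, eventually_ge_atTop 0,
      eventually_ge_atTop (2 * (n * M.T + s) / a)] with l h1 h0 h3
    rw [div_le_iff₀ ha] at h3
    rw [norm_mul, norm_pow, Real.norm_eq_abs, Real.norm_eq_abs, Real.norm_eq_abs,
      Real.abs_exp, Real.abs_exp, one_mul]
    calc Real.exp (-(M.V l - s * l) / M.T) * |deriv M.V l| ^ n
        ≤ Real.exp (-(M.V l - s * l) / M.T) * Real.exp l ^ n := by gcongr; exact h1.2
      _ = Real.exp (-(M.V l - s * l) / M.T + n * l) := by rw [← Real.exp_nat_mul, ← Real.exp_add]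
      _ ≤ _ := by
        apply Real.exp_le_exp.2
        have e1 : -(M.V l - s * l) / M.T + n * l = (-(M.V l - s * l) + n * l * M.T) / M.T := by
          field_simp
        have e2 : -(a / (2 * M.T)) * l ^ 2 = (-(a / 2) * l ^ 2) / M.T := by
          field_simp
        rw [e1, e2]
        apply div_le_div_of_nonneg_right _ hT.le
        nlinarith [h1.1, mul_le_mul_of_nonneg_right h3 h0]
  have hc : Continuous (fun r : ℝ => Real.exp (-(M.V r - M.τ * r) / M.T) * (deriv M.V r) ^ n) := by
    have h1 := M.continuous_deriv_V
    have h2 := M.potential.smooth.continuous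
    fun_prop
  have hg : Integrable (fun l : ℝ => Real.exp (-(a / (2 * M.T)) * l ^ 2)) :=
    integrable_exp_neg_mul_sq (by positivity)
  refine hc.locallyIntegrable.integrable_of_isBigO_atBot_atTop (g := fun l : ℝ =>
    Real.exp (-(a / (2 * M.T)) * l ^ 2)) ?_ (hg.integrableAtFilter _) (key M.τ)
    (hg.integrableAtFilter _)
  have h := (key (-M.τ)).comp_tendsto tendsto_neg_atBot_atTop
  refine (Asymptotics.isBigO_norm_left.1 (?_ : _ =O[atBot] _))
  refine (Asymptotics.isBigO_norm_left.2 h).congr (fun l => ?_) (fun l => ?_)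
  · simp only [Function.comp, deriv_V_neg, M.potential.even, norm_mul, norm_pow, norm_neg]
    congr 4
    ring
  · simp [Function.comp]

instance : IsProbabilityMeasure M.rLaw :=
  isProbabilityMeasure_tilted (by simpa using M.integrable_deriv_pow 0)

instance : IsProbabilityMeasure M.siteLaw := by
  unfold siteLaw; infer_instance

/-- The infinite volume Gibbs measure with tension `τ` and temperature `T`. -/
def gibbs : Measure Config := Measure.infinitePi (fun _ : ℤ => M.siteLaw)

instance : IsProbabilityMeasure M.gibbs := by
  unfold gibbs; infer_instance

lemma measurable_shift (x : ℤ) : Measurable (shift x) :=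
  measurable_pi_lambda _ fun z => measurable_pi_apply (x + z)

lemma measurePreserving_shift (x : ℤ) : MeasurePreserving (shift x) M.gibbs M.gibbs := by
  refine ⟨measurable_shift x, ?_⟩
  have h := Measure.map_infinitePi_infinitePi_of_inj (P := fun _ : ℤ => M.siteLaw)
    (f := fun z : ℤ => x + z) (add_right_injective x)
  exact h

lemma measurePreserving_eval (x : ℤ) :
    MeasurePreserving (fun η : Config => η x) M.gibbs M.siteLaw :=
  measurePreserving_eval_infinitePi (fun _ : ℤ => M.siteLaw) x

/-! ### The Hilbert space -/

/-- Local functions that are square integrable for the Gibbs measure. -/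
def localSubmodule : Submodule ℝ (Config → ℝ) where
  carrier := {f | Measurable f ∧ (∃ Λ : Finset ℤ, DependsOn f (Λ : Set ℤ)) ∧ MemLp f 2 M.gibbs}
  add_mem' := by
    rintro f g ⟨hf, ⟨S, hS⟩, hf2⟩ ⟨hg, ⟨R, hR⟩, hg2⟩
    refine ⟨hf.add hg, ⟨S ∪ R, fun η ζ h => ?_⟩, hf2.add hg2⟩
    simp only [Pi.add_apply]
    rw [hS fun i hi => h i (by simp at hi ⊢; exact Or.inl hi),
      hR fun i hi => h i (by simp at hi ⊢; exact Or.inr hi)]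
  zero_mem' := ⟨measurable_const, ⟨∅, fun _ _ _ => rfl⟩, MemLp.zero⟩
  smul_mem' := by
    rintro c f ⟨hf, ⟨S, hS⟩, hf2⟩
    refine ⟨hf.const_smul c, ⟨S, fun η ζ h => ?_⟩, hf2.const_smul c⟩
    simp only [Pi.smul_apply]
    rw [hS h]

/-- The vector space of local square integrable functions. It is a copy of the submodule, so that it
does not inherit the topology of pointwise convergence. -/
def LocalFun : Type := M.localSubmodule

instance : AddCommGroup M.LocalFun := inferInstanceAs (AddCommGroup M.localSubmodule)
instance : Module ℝ M.LocalFun := inferInstanceAs (Module ℝ M.localSubmodule)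

variable {M}

/-- The underlying function of a local function. -/
def LocalFun.fn (f : M.LocalFun) : Config → ℝ := Subtype.val (p := (· ∈ M.localSubmodule)) f

instance : CoeFun M.LocalFun (fun _ => Config → ℝ) := ⟨LocalFun.fn⟩

lemma LocalFun.measurable (f : M.LocalFun) : Measurable f := f.2.1
lemma LocalFun.memLp (f : M.LocalFun) : MemLp f 2 M.gibbs := f.2.2.2

lemma LocalFun.memLp_shift (f : M.LocalFun) (x : ℤ) : MemLp (fun η => f (shift x η)) 2 M.gibbs :=
  f.memLp.comp_measurePreserving (M.measurePreserving_shift x)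

lemma LocalFun.integrable_mul_shift (f g : M.LocalFun) (x y : ℤ) :
    Integrable (fun η => f (shift x η) * g (shift y η)) M.gibbs :=
  (f.memLp_shift x).integrable_mul (g.memLp_shift y)

lemma shift_zero (η : Config) : shift 0 η = η := by funext z; simp [shift]

lemma LocalFun.integrable_mul_shift' (f g : M.LocalFun) (x : ℤ) :
    Integrable (fun η => f η * g (shift x η)) M.gibbs := by
  simpa only [shift_zero] using f.integrable_mul_shift g 0 x

variable (M) in
/-- The `x`-th term `μ(f θ_x g) - μ(f) μ(g)` of the semi-inner product. -/
def corr (f g : Config → ℝ) (x : ℤ) : ℝ :=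
  ∫ η, f η * g (shift x η) ∂M.gibbs - (∫ η, f η ∂M.gibbs) * ∫ η, g η ∂M.gibbs

variable (M) in
/-- The semi-inner product `⟪f, g⟫ = ∑_x {μ(f θ_x g) - μ(f) μ(g)}`. For local functions the sum has
only finitely many nonzero terms. -/
def semiInner (f g : Config → ℝ) : ℝ := ∑ᶠ x : ℤ, M.corr f g x

lemma integral_mul_of_disjoint {f g : Config → ℝ} (hf : Measurable f) (hg : Measurable g)
    {S R : Finset ℤ} (hS : DependsOn f (S : Set ℤ)) (hR : DependsOn g (R : Set ℤ))
    (h : Disjoint S R) :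
    ∫ η, f η * g η ∂M.gibbs = (∫ η, f η ∂M.gibbs) * ∫ η, g η ∂M.gibbs := by
  have hi : iIndepFun (fun (i : ℤ) (η : Config) => η i) M.gibbs :=
    iIndepFun_infinitePi (P := fun _ : ℤ => M.siteLaw) (X := fun _ => id) (fun _ => measurable_id)
  have hi2 := hi.indepFun_finset S R h (fun i => measurable_pi_apply i)
  have ext : ∀ (S : Finset ℤ) (f : Config → ℝ), Measurable f → DependsOn f (S : Set ℤ) →
      ∃ φ : (S → ℝ × ℝ) → ℝ, Measurable φ ∧ f = φ ∘ (fun (η : Config) (i : S) => η i) := by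
    intro S f hf hS
    refine ⟨fun y => f (fun i => if h : i ∈ S then y ⟨i, h⟩ else 0), hf.comp ?_, ?_⟩
    · refine measurable_pi_lambda _ fun i => ?_
      by_cases h : i ∈ S
      · simp only [h, dite_true]; exact measurable_pi_apply _
      · simp only [h, dite_false]; exact measurable_const
    · funext η
      refine hS fun i hi => ?_
      have : i ∈ S := hi
      simp [this]
  obtain ⟨φ, hφ, rfl⟩ := ext S f hf hS
  obtain ⟨ψ, hψ, rfl⟩ := ext R g hg hR
  exact (hi2.comp hφ hψ).integral_fun_mul_eq_mul_integral hf.aestronglyMeasurable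
    hg.aestronglyMeasurable

lemma integral_shift (f : Config → ℝ) (hf : Measurable f) (x : ℤ) :
    ∫ η, f (shift x η) ∂M.gibbs = ∫ η, f η ∂M.gibbs := by
  conv_rhs => rw [← (M.measurePreserving_shift x).map_eq]
  rw [integral_map (measurable_shift x).aemeasurable hf.aestronglyMeasurable]

lemma shift_shift (x y : ℤ) (η : Config) : shift x (shift y η) = shift (y + x) η := by
  funext z; simp [shift, add_assoc]

lemma corr_support_finite (f g : M.LocalFun) : (Function.support (M.corr f g)).Finite := by
  obtain ⟨S, hS⟩ := f.2.2.1
  obtain ⟨R, hR⟩ := g.2.2.1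
  refine ((S ×ˢ R).image (fun q => q.1 - q.2)).finite_toSet.subset fun x hx => ?_
  by_contra hn
  apply hx
  have hd : DependsOn (fun η => g (shift x η)) ((R.image (fun z => x + z) : Finset ℤ) : Set ℤ) := by
    intro η ζ h
    refine hR fun i hi => h (x + i) ?_
    simp only [Finset.coe_image]
    exact ⟨i, hi, rfl⟩
  have hdisj : Disjoint S (R.image (fun z => x + z)) := by
    rw [Finset.disjoint_left]
    intro i hi hi'
    obtain ⟨z, hz, rfl⟩ := Finset.mem_image.1 hi'
    apply hn
    simp only [Finset.coe_image, Set.mem_image]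
    exact ⟨(x + z, z), by simpa using ⟨hi, hz⟩, by simp⟩
  have hg : Measurable (fun η => g (shift x η)) := g.measurable.comp (measurable_shift x)
  rw [corr, integral_mul_of_disjoint (M := M) f.measurable hg hS hd hdisj,
    integral_shift _ g.measurable, sub_self]

lemma corr_symm (f g : M.LocalFun) (x : ℤ) : M.corr g f x = M.corr f g (-x) := by
  have h := integral_shift (M := M) (fun η => f η * g (shift (-x) η))
    (f.measurable.mul (g.measurable.comp (measurable_shift _))) x
  simp only [shift_shift, add_neg_cancel] at h
  simp only [shift_zero] at h
  rw [corr, corr, ← h]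
  simp only [mul_comm]

lemma corr_add (f g h : M.LocalFun) (x : ℤ) :
    M.corr (f + g : M.LocalFun) h x = M.corr f h x + M.corr g h x := by
  have e : ∀ η, (f + g : M.LocalFun) η = f η + g η := fun _ => rfl
  simp only [corr, e, add_mul]
  rw [integral_add (f.integrable_mul_shift' h x) (g.integrable_mul_shift' h x), integral_add (f.memLp.integrable (by norm_num))
    (g.memLp.integrable (by norm_num))]
  ring

lemma corr_smul (c : ℝ) (f g : M.LocalFun) (x : ℤ) :
    M.corr (c • f : M.LocalFun) g x = c * M.corr f g x := by
  have e : ∀ η, (c • f : M.LocalFun) η = c * f η := fun _ => rfl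
  simp only [corr, e, mul_assoc, integral_const_mul]
  ring

lemma sum_corr_nonneg (f : M.LocalFun) (N : ℕ) :
    0 ≤ ∑ x ∈ Finset.range N, ∑ y ∈ Finset.range N, M.corr f f ((y : ℤ) - x) := by
  set m := ∫ η, f η ∂M.gibbs with hm
  have key : ∀ x y : ℤ, M.corr f f (y - x) =
      ∫ η, (f (shift x η) - m) * (f (shift y η) - m) ∂M.gibbs := by
    intro x y
    have h := integral_shift (M := M) (fun η => f η * f (shift (y - x) η))
      (f.measurable.mul (f.measurable.comp (measurable_shift _))) x
    simp only [shift_shift, add_sub_cancel] at h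
    have i1 := (f.memLp_shift x).integrable (by norm_num)
    have i2 := (f.memLp_shift y).integrable (by norm_num)
    have e : ∀ η, (f (shift x η) - m) * (f (shift y η) - m) =
        f (shift x η) * f (shift y η) - m * f (shift x η) - m * f (shift y η) + m * m :=
      fun η => by ring
    simp only [e]
    have i3 := f.integrable_mul_shift f x y
    have i4 : Integrable (fun η => f (shift x η) * f (shift y η) - m * f (shift x η)) M.gibbs :=
      i3.sub (i1.const_mul m)
    have i5 : Integrable (fun η => f (shift x η) * f (shift y η) - m * f (shift x η)
        - m * f (shift y η)) M.gibbs := i4.sub (i2.const_mul m)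
    rw [integral_add i5 (integrable_const _), integral_sub i4 (i2.const_mul m),
      integral_sub i3 (i1.const_mul m), integral_const_mul, integral_const_mul,
      integral_shift _ f.measurable, integral_shift _ f.measurable, corr, h]
    simp only [← hm, integral_const, probReal_univ, one_smul]
    ring
  have hL : ∀ x : ℤ, MemLp (fun η => f (shift x η) - m) 2 M.gibbs :=
    fun x => (f.memLp_shift x).sub (memLp_const m)
  have : ∑ x ∈ Finset.range N, ∑ y ∈ Finset.range N, M.corr f f ((y : ℤ) - x) =
      ∫ η, (∑ x ∈ Finset.range N, (f (shift (x : ℤ) η) - m)) ^ 2 ∂M.gibbs := by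
    simp only [key, sq, Finset.sum_mul_sum]
    rw [integral_finsetSum]
    · refine Finset.sum_congr rfl fun x _ => ?_
      rw [integral_finsetSum]
      exact fun y _ => (hL x).integrable_mul (hL y)
    · exact fun x _ => integrable_finsetSum _ fun y _ => (hL x).integrable_mul (hL y)
  rw [this]
  exact integral_nonneg fun η => sq_nonneg _

lemma semiInner_nonneg (f : M.LocalFun) : 0 ≤ M.semiInner f f := by
  set c := M.corr f f with hc
  have hfin := corr_support_finite f f
  obtain ⟨K, hK⟩ : ∃ K : ℕ, ∀ x ∈ hfin.toFinset, x.natAbs ≤ K :=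
    ⟨hfin.toFinset.sup Int.natAbs, fun x hx => Finset.le_sup (f := Int.natAbs) hx⟩
  have hK' : ∀ x : ℤ, K < x.natAbs → c x = 0 := by
    intro x hx
    by_contra h
    have := hK x (hfin.mem_toFinset.2 h)
    omega
  set s := Finset.Icc (-(K : ℤ)) K with hs
  have hsupp : Function.support c ⊆ s := by
    intro x hx
    have := hK x (hfin.mem_toFinset.2 hx)
    simp only [hs, Finset.coe_Icc, Set.mem_Icc]
    omega
  have hS : M.semiInner f f = ∑ x ∈ s, c x := finsum_eq_sum_of_support_subset _ hsupp
  set A := ∑ x ∈ s, |c x| with hA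
  by_contra! hneg
  rw [hS] at hneg
  set B := ∑ x ∈ s, c x with hB
  -- each row is at most `A`, and equals `B` away from the boundary
  have inner_eq : ∀ (N x : ℕ), ∑ y ∈ Finset.range N, c ((y : ℤ) - x) =
      ∑ z ∈ s, if (0 ≤ z + x ∧ z + x < N) then c z else 0 := by
    intro N x
    rw [← Finset.sum_filter]
    symm
    apply Finset.sum_of_injOn (fun z : ℤ => (z + x).toNat)
    · intro a ha b hb hab
      simp at ha hb hab
      omega
    · intro a ha
      simp at ha ⊢
      omega
    · intro y hy hy'
      apply hK'
      by_contra hcon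
      apply hy'
      refine ⟨(y : ℤ) - x, ?_, by simp⟩
      simp [hs] at hy ⊢
      omega
    · intro z hz
      simp at hz
      congr 1
      omega
  have row_le : ∀ N x : ℕ, ∑ y ∈ Finset.range N, c ((y : ℤ) - x) ≤ A := by
    intro N x
    rw [inner_eq]
    refine Finset.sum_le_sum fun z _ => ?_
    split_ifs
    · exact le_abs_self _
    · exact abs_nonneg _
  have row_eq : ∀ N x : ℕ, K ≤ x → x + K < N →
      ∑ y ∈ Finset.range N, c ((y : ℤ) - x) = B := by
    intro N x h1 h2
    rw [inner_eq]
    refine Finset.sum_congr rfl fun z hz => ?_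
    simp only [hs, Finset.mem_Icc] at hz
    rw [if_pos (by omega)]
  have hA0 : 0 ≤ A := Finset.sum_nonneg fun _ _ => abs_nonneg _
  have bound : ∀ n : ℕ, 0 ≤ (n : ℝ) * B + (2 * K) * A := by
    intro n
    refine (sum_corr_nonneg f (K + n + K)).trans ?_
    rw [Finset.sum_range_add, Finset.sum_range_add]
    have b1 : ∑ x ∈ Finset.range K, ∑ y ∈ Finset.range (K + n + K), c ((y : ℤ) - x) ≤ K * A := by
      simpa using Finset.sum_le_card_nsmul (Finset.range K) _ A fun x _ => row_le (K + n + K) x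
    have b2 : ∑ x ∈ Finset.range n, ∑ y ∈ Finset.range (K + n + K),
        c ((y : ℤ) - ((K + x : ℕ) : ℤ)) = n * B := by
      rw [Finset.sum_congr rfl fun x hx => row_eq (K + n + K) (K + x) (by omega)
        (by simp at hx; omega)]
      simp
    have b3 : ∑ x ∈ Finset.range K, ∑ y ∈ Finset.range (K + n + K),
        c ((y : ℤ) - ((K + n + x : ℕ) : ℤ)) ≤ K * A := by
      simpa using Finset.sum_le_card_nsmul (Finset.range K) _ A
        fun x _ => row_le (K + n + K) (K + n + x)
    linarith
  obtain ⟨n, hn⟩ := exists_nat_gt ((2 * K) * A / (-B))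
  rw [div_lt_iff₀ (by linarith)] at hn
  linarith [bound n]

variable (M)

/-- The semi-inner product on local functions. -/
@[reducible]
def preInnerCore : PreInnerProductSpace.Core ℝ M.LocalFun where
  inner f g := M.semiInner f g
  conj_inner_symm f g := by
    simp only [conj_trivial, semiInner, corr_symm f g]
    exact finsum_comp_equiv (Equiv.neg ℤ)
  re_inner_nonneg f := semiInner_nonneg f
  add_left f g h := by
    simp only [semiInner, corr_add]
    exact finsum_add_distrib (corr_support_finite f h) (corr_support_finite g h)
  smul_left f g c := by
    simp only [semiInner, corr_smul, conj_trivial]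
    exact (mul_finsum _ _).symm

instance : SeminormedAddCommGroup M.LocalFun :=
  @InnerProductSpace.Core.toSeminormedAddCommGroup ℝ _ _ _ _ M.preInnerCore

instance : InnerProductSpace ℝ M.LocalFun := InnerProductSpace.ofCore M.preInnerCore

/-- The Hilbert space: completion of the local functions for the semi-inner product. -/
abbrev Hilb : Type := UniformSpace.Completion M.LocalFun

variable {M} in
/-- The class in the Hilbert space of a local function. -/
def LocalFun.toHilb (f : M.LocalFun) : M.Hilb := (f : UniformSpace.Completion M.LocalFun)

/-! ### The generator, its resolvent, and the Green-Kubo quantities -/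

/-- The graph of the generator: the closure of the graph of the formal generator on (the linear span
of) the compactly supported local `C¹` functions. -/
def generatorGraph : Submodule ℝ (M.Hilb × M.Hilb) :=
  (Submodule.span ℝ {q : M.Hilb × M.Hilb | ∃ f g : M.LocalFun, IsLocalTest f ∧
    (∀ η, g η = M.formalGenerator f η) ∧ q = (f.toHilb, g.toHilb)}).topologicalClosure

/-- The closure of the formal generator is the infinitesimal generator of a strongly continuous
one-parameter semigroup `P` of bounded operators: `(u, v)` is in its graph if and only if
`(P_t u - u) / t` tends to `v` as `t` decreases to `0`. -/
def GeneratesSemigroup : Prop :=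
  ∃ P : ℝ≥0 → M.Hilb →L[ℝ] M.Hilb,
    P 0 = ContinuousLinearMap.id ℝ M.Hilb ∧
    (∀ s t, P (s + t) = (P s).comp (P t)) ∧
    (∀ u, Continuous fun t => P t u) ∧
    ∀ u v : M.Hilb, (u, v) ∈ M.generatorGraph ↔
      Tendsto (fun t : ℝ≥0 => (t : ℝ)⁻¹ • (P t u - u)) (𝓝[>] 0) (𝓝 v)

/-- `u` solves the resolvent equation: `u` is in the domain of the generator `L` and
`l u - L u = g`. -/
def SolvesResolvent (l : ℝ) (g u : M.Hilb) : Prop := (u, l • u - g) ∈ M.generatorGraph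

open Classical in
/-- `(l - L)⁻¹ g`, the unique solution of the resolvent equation (and `0` if there is not exactly
one solution). -/
def resolvent (l : ℝ) (g : M.Hilb) : M.Hilb :=
  if h : ∃! u, M.SolvesResolvent l g u then h.choose else 0

/-- `σ(f, g) = lim_{l ↓ 0} ⟪f, (l - L)⁻¹ g⟫`. -/
def sigma (f g : M.Hilb) : ℝ :=
  limUnder (𝓝[>] (0 : ℝ)) (fun l => inner ℝ f (M.resolvent l g))

lemma memLp_p (x : ℤ) (q : ℝ≥0∞) (hq : q ≠ ∞) :
    MemLp (fun η : Config => (η x).2) q M.gibbs := by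
  have h : MemLp (fun z : ℝ × ℝ => z.2) q M.siteLaw :=
    (memLp_id_gaussianReal' q hq).comp_measurePreserving measurePreserving_snd
  exact h.comp_measurePreserving (M.measurePreserving_eval x)

lemma memLp_deriv_V (x : ℤ) : MemLp (fun η : Config => deriv M.V (η x).1) 4 M.gibbs := by
  have h0 : MemLp (deriv M.V) 4 M.rLaw := by
    have hm : AEStronglyMeasurable (deriv M.V) M.rLaw :=
      M.continuous_deriv_V.aestronglyMeasurable
    rw [← integrable_norm_rpow_iff hm (by norm_num) (by norm_num), rLaw, integrable_tilted_iff]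
    · have h := M.integrable_deriv_pow 4
      refine h.congr (Eventually.of_forall fun r => ?_)
      have e : ((4 : ℝ≥0∞).toReal) = ((4 : ℕ) : ℝ) := by norm_num
      simp only [e, Real.rpow_natCast, Real.norm_eq_abs, smul_eq_mul]
      rw [Even.pow_abs (by decide)]
    · simpa using M.integrable_deriv_pow 0
  have h : MemLp (fun z : ℝ × ℝ => deriv M.V z.1) 4 M.siteLaw :=
    h0.comp_measurePreserving measurePreserving_fst
  exact h.comp_measurePreserving (M.measurePreserving_eval x)

/-- The momentum `p_0` of the particle at the origin. -/
def p0 : M.LocalFun :=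
  ⟨fun η => (η 0).2, by fun_prop, ⟨{0}, fun η ζ h => by simp only [h 0 (by simp)]⟩,
    M.memLp_p 0 2 (by norm_num)⟩

/-- The energy current `j_{0,1} = -p_0 V'(r_1)` of the infinite chain. -/
def j01 : M.LocalFun :=
  ⟨fun η => -((η 0).2 * deriv M.V (η 1).1),
    by have := M.continuous_deriv_V.measurable; fun_prop,
    ⟨{0, 1}, fun η ζ h => by simp only [h 0 (by simp), h 1 (by simp)]⟩,
    (MemLp.mul (p := 4) (q := 4) (r := 2) (M.memLp_deriv_V 1) (M.memLp_p 0 4 (by norm_num))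
      (hpqr := ⟨by
        rw [show (4 : ℝ≥0∞) = 2 * 2 by norm_num, ENNReal.mul_inv (by simp) (by simp), ← mul_add,
          ENNReal.inv_two_add_inv_two, mul_one]⟩)).neg⟩

/-- The coefficient `κ^{e,r} = -T⁻¹ ⟪p_0, (-L)⁻¹ (j_{0,1} + τ p_0)⟫`, with `(-L)⁻¹` the limit of
`(l - L)⁻¹` as `l ↓ 0`. -/
def kappaER : ℝ := -M.T⁻¹ * M.sigma M.p0.toHilb (M.j01 + M.τ • M.p0).toHilb

/-- The coefficient `κ^{r,e} = -T⁻² ⟪j_{0,1} + τ p_0, (-L)⁻¹ p_0⟫`, with `(-L)⁻¹` the limit of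
`(l - L)⁻¹` as `l ↓ 0`. -/
def kappaRE : ℝ := -(M.T ^ 2)⁻¹ * M.sigma (M.j01 + M.τ • M.p0).toHilb M.p0.toHilb

end OscillatorChain

end

noncomputable section

/-! ### Dissipative generators of strongly continuous semigroups -/

section Semigroup

variable {E : Type*} [NormedAddCommGroup E] [InnerProductSpace ℝ E]

/-! The point is that in the Hilbert space $\mathcal H$ the momentum $p_0$ is an eigenvector of the
generator and of its adjoint, with eigenvalue $-2\gamma$. Formally $\mathfrak L p_0 =
V'(r_1)-V'(r_0)-2\gamma p_0$, and the gradient $V'(r_1)-V'(r_0)$ has zero norm, because the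
semi-inner product sums over all translations (`LocalFun.toHilb_translate`). Since $p_0$ is not
compactly supported, it is reached by truncation (`exists_approx_p0`, `p0_mem_generatorGraph`). The
adjoint statement `inner_p0_of_mem_generatorGraph` follows from the antisymmetry of the Liouville
part (`semiInner_liouville`) and the symmetry of the noise (`LocalFun.semiInner_noise_comm`).

Hence $(\lambda-\mathfrak L)^{-1}p_0=(\lambda+2\gamma)^{-1}p_0$ and $\ll p_0,(\lambda-\mathfrak
L)^{-1}g\gg\,=(\lambda+2\gamma)^{-1}\ll p_0,g\gg$. Both Green-Kubo quantities are therefore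
multiples of $\ll j_{0,1}+\tau p_0,\,p_0\gg$, which vanishes because $V'(r_1)$ has mean $\tau$ and
is independent of $p_0$ (`inner_current_p0`). They are zero for every $\lambda>0$, before any limit.

Bijectivity of $\lambda-\mathfrak L$ for every $\lambda>0$ comes from dissipativity
(`generatorGraph_dissipative`): the Liouville part contributes nothing to $\ll f,\mathfrak L f\gg$
and the noise gives minus a Dirichlet form. A semigroup with dissipative generator is a contraction
semigroup (`semigroup_contraction`), and its resolvent is then built explicitly
(`existsUnique_resolvent_of_dissipative`). -/

lemma tendsto_coe_nnreal_nhdsGT_zero :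
    Tendsto (fun h : ℝ≥0 => (h : ℝ)) (𝓝[>] 0) (𝓝[>] 0) := by
  refine tendsto_nhdsWithin_iff.2 ⟨?_, ?_⟩
  · exact (NNReal.continuous_coe.tendsto' 0 0 rfl).mono_left nhdsWithin_le_nhds
  · filter_upwards [self_mem_nhdsWithin] with h hh
    exact NNReal.coe_pos.2 hh

lemma tendsto_toNNReal_nhdsGT_zero :
    Tendsto Real.toNNReal (𝓝[>] 0) (𝓝[>] 0) := by
  refine tendsto_nhdsWithin_iff.2 ⟨?_, ?_⟩
  · exact (continuous_real_toNNReal.tendsto' 0 0 (by simp)).mono_left nhdsWithin_le_nhds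
  · filter_upwards [self_mem_nhdsWithin] with h hh
    exact Real.toNNReal_pos.2 hh

/-- The orbit integral `∫₀ᵗ e^{-ls} P_s g ds` is in the domain of the generator. -/
lemma tendsto_slope_orbit_integral [CompleteSpace E] (P : ℝ≥0 → E →L[ℝ] E)
    (h0 : P 0 = ContinuousLinearMap.id ℝ E) (hadd : ∀ s t, P (s + t) = (P s).comp (P t))
    (hcont : ∀ u, Continuous fun t => P t u) (l : ℝ) (t : ℝ≥0) (g : E) :
    Tendsto (fun h : ℝ≥0 => (h : ℝ)⁻¹ •
        (P h (∫ s in (0 : ℝ)..t, Real.exp (-l * s) • P s.toNNReal g) -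
          ∫ s in (0 : ℝ)..t, Real.exp (-l * s) • P s.toNNReal g))
      (𝓝[>] 0) (𝓝 (l • (∫ s in (0 : ℝ)..t, Real.exp (-l * s) • P s.toNNReal g) -
        (g - Real.exp (-l * t) • P t g))) := by
  set F : ℝ → E := fun s => Real.exp (-l * s) • P s.toNNReal g with hF
  have hFc : Continuous F :=
    (by fun_prop : Continuous fun s : ℝ => Real.exp (-l * s)).smul
      ((hcont g).comp continuous_real_toNNReal)
  have hFi : ∀ a b : ℝ, IntervalIntegrable F volume a b := fun a b => hFc.intervalIntegrable a b
  set J : ℝ → E := fun x => ∫ s in (0 : ℝ)..x, F s with hJ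
  have hJd : ∀ x, HasDerivAt J (F x) x := fun x =>
    intervalIntegral.integral_hasDerivAt_right (hFi 0 x)
      hFc.aestronglyMeasurable.stronglyMeasurableAtFilter hFc.continuousAt
  -- This is the closed form of `P h (J t)` proved in `hP`. Unlike the orbit, it makes sense for `h`
  -- of both signs, so its derivative at 0 is ordinary calculus.
  have hk : HasDerivAt (fun h : ℝ => Real.exp (l * h) • (J (t + h) - J h))
      (l • J t - (F 0 - F t)) 0 := by
    have e1 : HasDerivAt (fun h : ℝ => Real.exp (l * h)) (Real.exp (l * 0) * (l * 1)) 0 :=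
      ((hasDerivAt_id (0 : ℝ)).const_mul l).exp
    have e2 : HasDerivAt (fun h : ℝ => J (t + h)) (F (t + 0)) 0 := (hJd _).comp_const_add _ _
    have hJ0 : J 0 = 0 := by simp [hJ]
    refine (e1.smul (e2.sub (hJd 0))).congr_deriv ?_
    simp only [mul_zero, Real.exp_zero, add_zero, one_smul, mul_one, one_mul, Pi.sub_apply, hJ0,
      sub_zero]
    abel
  -- The semigroup law turns `P h (F s)` into `exp (l h) • F (s + h)`; a translation of the variable
  -- does the rest.
  have hP : ∀ h : ℝ≥0, P h (J t) = Real.exp (l * h) • (J (t + h) - J h) := by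
    intro h
    have e1 : P h (J t) = ∫ s in (0 : ℝ)..t, P h (F s) :=
      ((P h).intervalIntegral_comp_comm (hFi 0 t)).symm
    have e2 : ∫ s in (0 : ℝ)..t, P h (F s) = ∫ s in (0 : ℝ)..t, Real.exp (l * h) • F (s + h) := by
      refine intervalIntegral.integral_congr fun s hs => ?_
      rw [Set.uIcc_of_le (NNReal.coe_nonneg t)] at hs
      have hs' : (s + h).toNNReal = h + s.toNNReal := by
        rw [Real.toNNReal_add hs.1 (NNReal.coe_nonneg h), Real.toNNReal_coe, add_comm]
      simp only [hF, hs', hadd, map_smul, ContinuousLinearMap.comp_apply, smul_smul,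
        ← Real.exp_add]
      congr 2
      ring
    rw [e1, e2, intervalIntegral.integral_smul, intervalIntegral.integral_comp_add_right, zero_add]
    simp only [hJ]
    rw [intervalIntegral.integral_interval_sub_left (hFi _ _) (hFi _ _)]
  have hF0 : F 0 = g := by simp [hF, h0]
  have hFt : F t = Real.exp (-l * t) • P t g := by simp [hF]
  rw [hF0, hFt] at hk
  have h1 := (hasDerivAt_iff_tendsto_slope_zero.1 hk).comp
    (tendsto_coe_nnreal_nhdsGT_zero.mono_right (nhdsWithin_mono 0 fun x hx => ne_of_gt hx))
  refine h1.congr fun h => ?_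
  have hJ0 : J 0 = 0 := by simp [hJ]
  simp only [Function.comp, zero_add, mul_zero, Real.exp_zero, add_zero, one_smul, hJ0, sub_zero]
  rw [← hP]

/-- A dissipative operator which generates a strongly continuous semigroup generates a contraction
semigroup. -/
lemma semigroup_contraction [CompleteSpace E] (G : Submodule ℝ (E × E))
    (hdiss : ∀ q ∈ G, inner ℝ q.1 q.2 ≤ 0) (P : ℝ≥0 → E →L[ℝ] E)
    (h0 : P 0 = ContinuousLinearMap.id ℝ E) (hadd : ∀ s t, P (s + t) = (P s).comp (P t))
    (hcont : ∀ u, Continuous fun t => P t u)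
    (hgen : ∀ u v : E, (u, v) ∈ G ↔
      Tendsto (fun t : ℝ≥0 => (t : ℝ)⁻¹ • (P t u - u)) (𝓝[>] 0) (𝓝 v))
    (t : ℝ≥0) (g : E) : ‖P t g‖ ≤ ‖g‖ := by
  -- On the domain, ‖P_s u‖² has right derivative 2⟨P_s u, P_s v⟩, where P_s v is the image of P_s u
  -- under the generator; dissipativity makes it nonpositive.
  have hdom : ∀ u v : E, (u, v) ∈ G → ‖P t u‖ ≤ ‖u‖ := by
    intro u v huv
    have hmem : ∀ s : ℝ≥0, (P s u, P s v) ∈ G := by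
      intro s
      rw [hgen] at huv ⊢
      refine (((P s).continuous.tendsto v).comp huv).congr fun h => ?_
      have e : P h (P s u) = P s (P h u) := by
        rw [← ContinuousLinearMap.comp_apply, ← hadd, add_comm, hadd,
          ContinuousLinearMap.comp_apply]
      simp [e]
    have hd : ∀ s : ℝ, 0 ≤ s → HasDerivWithinAt (fun s : ℝ => P s.toNNReal u)
        (P s.toNNReal v) (Set.Ici s) s := by
      intro s hs
      rw [← hasDerivWithinAt_Ioi_iff_Ici, hasDerivWithinAt_iff_tendsto_slope' (by simp)]
      have h1 := ((hgen _ _).1 (hmem s.toNNReal)).comp tendsto_toNNReal_nhdsGT_zero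
      have h2 : Tendsto (fun x : ℝ => x - s) (𝓝[>] s) (𝓝[>] 0) := by
        refine tendsto_nhdsWithin_iff.2 ⟨?_, ?_⟩
        · exact ((continuous_sub_right s).tendsto' s 0 (by simp)).mono_left nhdsWithin_le_nhds
        · filter_upwards [self_mem_nhdsWithin] with x hx
          exact sub_pos.2 (Set.mem_Ioi.1 hx)
      refine (h1.comp h2).congr' ?_
      filter_upwards [self_mem_nhdsWithin] with x hx
      have hx : s < x := hx
      have e : P x.toNNReal u = P (x - s).toNNReal (P s.toNNReal u) := by
        rw [← ContinuousLinearMap.comp_apply, ← hadd,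
          ← Real.toNNReal_add (sub_nonneg.2 hx.le) hs, sub_add_cancel]
      simp only [Function.comp, slope, vsub_eq_sub]
      rw [Real.coe_toNNReal _ (sub_nonneg.2 hx.le), e]
    have hsq := image_le_of_deriv_right_le_deriv_boundary (a := 0) (b := t)
      (f := fun s => ‖P s.toNNReal u‖ ^ 2)
      (f' := fun s => 2 * inner ℝ (P s.toNNReal u) (P s.toNNReal v))
      (((hcont u).comp continuous_real_toNNReal).norm.pow 2).continuousOn
      (fun s hs => (hd s hs.1).norm_sq) (B := fun _ => ‖u‖ ^ 2) (B' := fun _ => 0)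
      (by simp [h0]) continuousOn_const (fun s _ => hasDerivWithinAt_const _ _ _)
      (fun s _ => by
        have := hdiss _ (hmem s.toNNReal)
        simp only at this
        linarith) (x := t) ⟨t.2, le_rfl⟩
    simp only [Real.toNNReal_coe] at hsq
    exact (sq_le_sq₀ (norm_nonneg _) (norm_nonneg _)).1 hsq
  -- The domain is dense: the averages h⁻¹ ∫₀ʰ P_s g ds belong to it (orbit integral with `l = 0`)
  -- and tend to `g`, so the contraction bound extends to every vector.
  have horbit := fun h : ℝ≥0 => tendsto_slope_orbit_integral P h0 hadd hcont 0 h g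
  simp only [← hgen, neg_zero, zero_mul, Real.exp_zero, one_smul] at horbit
  have hFc : Continuous fun s : ℝ => P s.toNNReal g := (hcont g).comp continuous_real_toNNReal
  have hJd : HasDerivAt (fun x : ℝ => ∫ s in (0 : ℝ)..x, P s.toNNReal g) (P (0 : ℝ).toNNReal g) 0 :=
    intervalIntegral.integral_hasDerivAt_right (hFc.intervalIntegrable _ _)
      hFc.aestronglyMeasurable.stronglyMeasurableAtFilter hFc.continuousAt
  have hlim := (hasDerivAt_iff_tendsto_slope_zero.1 hJd).comp
    (tendsto_coe_nnreal_nhdsGT_zero.mono_right (nhdsWithin_mono 0 fun x hx => ne_of_gt hx))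
  simp only [Real.toNNReal_zero, h0, ContinuousLinearMap.id_apply, Function.comp_def, zero_add,
    intervalIntegral.integral_same, sub_zero] at hlim
  refine le_of_tendsto_of_tendsto (((P t).continuous.tendsto g).comp hlim).norm hlim.norm
    (Eventually.of_forall fun h => ?_)
  exact hdom _ _ (G.smul_mem (h : ℝ)⁻¹ (horbit h))

/-- The resolvent set of a dissipative generator contains the positive half line. -/
theorem existsUnique_resolvent_of_dissipative [CompleteSpace E] (G : Submodule ℝ (E × E))
    (hdiss : ∀ q ∈ G, inner ℝ q.1 q.2 ≤ 0) (P : ℝ≥0 → E →L[ℝ] E)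
    (h0 : P 0 = ContinuousLinearMap.id ℝ E) (hadd : ∀ s t, P (s + t) = (P s).comp (P t))
    (hcont : ∀ u, Continuous fun t => P t u)
    (hgen : ∀ u v : E, (u, v) ∈ G ↔
      Tendsto (fun t : ℝ≥0 => (t : ℝ)⁻¹ • (P t u - u)) (𝓝[>] 0) (𝓝 v))
    {l : ℝ} (hl : 0 < l) (g : E) : ∃! u : E, (u, l • u - g) ∈ G := by
  have hP1 : ‖P 1‖ ≤ 1 := ContinuousLinearMap.opNorm_le_bound _ zero_le_one fun u => by
    simpa using semigroup_contraction G hdiss P h0 hadd hcont hgen 1 u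
  -- A Neumann series inverts `1 - exp (-l) • P 1`. If `w` is the preimage of `g`, the integral over
  -- [0, 1] of exp(-ls) P_s w already solves the equation for `g`, so no improper Laplace integral
  -- is needed.
  have hlt : ‖Real.exp (-l) • P 1‖ < 1 := by
    rw [norm_smul, Real.norm_of_nonneg (Real.exp_pos _).le]
    have h1 : Real.exp (-l) < 1 := Real.exp_lt_one_iff.2 (by linarith)
    have h2 := Real.exp_pos (-l)
    nlinarith [norm_nonneg (P 1)]
  let U := Units.oneSub (Real.exp (-l) • P 1) hlt
  set w : E := (↑U⁻¹ : E →L[ℝ] E) g with hw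
  have hwg : w - Real.exp (-l) • P 1 w = g := by
    have h1 : ((U : E →L[ℝ] E) * (↑U⁻¹ : E →L[ℝ] E)) g = g := by rw [Units.mul_inv]; rfl
    have h2 : (U : E →L[ℝ] E) = 1 - Real.exp (-l) • P 1 := rfl
    rw [mul_apply_eq_comp, ← hw, h2] at h1
    exact h1
  have hmem := tendsto_slope_orbit_integral P h0 hadd hcont l 1 w
  rw [← hgen] at hmem
  simp only [NNReal.coe_one, mul_one, hwg] at hmem
  refine ⟨_, hmem, fun y hy => ?_⟩
  -- The difference `d` of two solutions is mapped to `l • d`, so dissipativity reads l‖d‖² ≤ 0.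
  have hsub := hdiss _ (G.sub_mem hy hmem)
  rw [← sub_eq_zero]
  set u := ∫ s in (0 : ℝ)..1, Real.exp (-l * s) • P s.toNNReal w
  have e : (y, l • y - g) - (u, l • u - g) = (y - u, l • (y - u)) := by
    simp [smul_sub]
  rw [e] at hsub
  simp only [inner_smul_right, real_inner_self_eq_norm_sq] at hsub
  have : ‖y - u‖ ^ 2 ≤ 0 := by nlinarith [sq_nonneg ‖y - u‖]
  exact norm_eq_zero.1 (by nlinarith [norm_nonneg (y - u)])

end Semigroup

/-! ### Integration by parts for the Gibbs measure -/

/-- Integration by parts for a probability density proportional to `exp W` on the line. -/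
lemma integral_deriv_tilted {W W' h h' : ℝ → ℝ} (hWi : Integrable fun s => Real.exp (W s))
    (hW : ∀ s, HasDerivAt W (W' s) s) (hh : ∀ s, HasDerivAt h (h' s) s)
    (i0 : Integrable h (volume.tilted W)) (i1 : Integrable h' (volume.tilted W))
    (i2 : Integrable (fun s => h s * W' s) (volume.tilted W)) :
    ∫ s, h' s ∂(volume.tilted W) = -∫ s, h s * W' s ∂(volume.tilted W) := by
  rw [integrable_tilted_iff hWi] at i0 i1 i2
  simp only [smul_eq_mul] at i0 i1 i2
  have key := integral_mul_deriv_eq_deriv_mul_of_integrable (u := fun s => Real.exp (W s))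
    (v := h) (u' := fun s => Real.exp (W s) * W' s) (v' := h')
    (fun s _ => (hW s).exp) (fun s _ => hh s) i1
    (i2.congr (Eventually.of_forall fun s => by simp only [Pi.mul_apply]; ring)) i0
  rw [integral_tilted, integral_tilted]
  simp only [smul_eq_mul, div_mul_eq_mul_div, integral_div]
  rw [key, ← neg_div]
  congr 2
  exact integral_congr_ae (Eventually.of_forall fun s => by simp only; ring)

/-- Puts the momentum law in the exponential form of the distance law, so that
`integral_deriv_tilted` serves both. -/
lemma gaussianReal_zero_eq_tilted {v : ℝ} (hv : 0 < v) :
    gaussianReal 0 v.toNNReal = volume.tilted fun p => -(2 * v)⁻¹ * p ^ 2 := by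
  have hv' : v.toNNReal ≠ 0 := by simpa using hv
  rw [gaussianReal_of_var_ne_zero _ hv', Measure.tilted]
  congr 1
  funext p
  rw [gaussianPDF, gaussianPDFReal, integral_gaussian, Real.coe_toNNReal _ hv.le]
  congr 1
  have h1 : Real.pi / (2 * v)⁻¹ = 2 * Real.pi * v := by field_simp
  have h2 : -(p - 0) ^ 2 / (2 * v) = -(2 * v)⁻¹ * p ^ 2 := by field_simp; ring
  rw [h1, h2, div_eq_inv_mul]

namespace OscillatorChain

variable {M : OscillatorChain}

/-! ### One-site integration by parts, then its extension to the infinite chain. -/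

lemma hasDerivAt_V (s : ℝ) : HasDerivAt M.V (deriv M.V s) s :=
  ((M.potential.smooth.differentiable (by norm_cast)) s).hasDerivAt

/-- The log-density has derivative -(V' - τ)/T; the factor T clears the denominator. For constant
`h` this says that V' has mean τ. -/
lemma integral_deriv_rLaw {h h' : ℝ → ℝ} (hh : ∀ s, HasDerivAt h (h' s) s)
    (i0 : Integrable h M.rLaw) (i1 : Integrable h' M.rLaw)
    (i2 : Integrable (fun s => h s * (deriv M.V s - M.τ)) M.rLaw) :
    M.T * ∫ s, h' s ∂M.rLaw = ∫ s, h s * (deriv M.V s - M.τ) ∂M.rLaw := by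
  have hT := M.T_pos.ne'
  have hW : ∀ s, HasDerivAt (fun r => -(M.V r - M.τ * r) / M.T)
      (-(deriv M.V s - M.τ) / M.T) s := fun s => by
    have := (((hasDerivAt_V (M := M) s).sub ((hasDerivAt_id s).const_mul M.τ)).neg).div_const M.T
    simpa using this
  have key := integral_deriv_tilted (by simpa using M.integrable_deriv_pow 0) hW hh i0 i1
    ((i2.const_mul (-M.T⁻¹)).congr (Eventually.of_forall fun s => by simp only; field_simp))
  rw [rLaw, key, ← integral_neg, ← integral_const_mul]
  exact integral_congr_ae (Eventually.of_forall fun s => by simp only; field_simp)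

lemma integral_deriv_gaussian {h h' : ℝ → ℝ} (hh : ∀ s, HasDerivAt h (h' s) s)
    (i0 : Integrable h (gaussianReal 0 M.T.toNNReal))
    (i1 : Integrable h' (gaussianReal 0 M.T.toNNReal))
    (i2 : Integrable (fun s => h s * s) (gaussianReal 0 M.T.toNNReal)) :
    M.T * ∫ s, h' s ∂(gaussianReal 0 M.T.toNNReal) =
      ∫ s, h s * s ∂(gaussianReal 0 M.T.toNNReal) := by
  have hT := M.T_pos
  rw [gaussianReal_zero_eq_tilted hT] at i0 i1 i2 ⊢
  have hW : ∀ s, HasDerivAt (fun p : ℝ => -(2 * M.T)⁻¹ * p ^ 2) (-s / M.T) s := fun s => by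
    refine ((hasDerivAt_pow 2 s).const_mul (-(2 * M.T)⁻¹)).congr_deriv ?_
    field_simp
    norm_num
  have key := integral_deriv_tilted (integrable_exp_neg_mul_sq (by positivity)) hW hh i0 i1
    ((i2.const_mul (-M.T⁻¹)).congr (Eventually.of_forall fun s => by simp only; field_simp))
  rw [key, ← integral_neg, ← integral_const_mul]
  exact integral_congr_ae (Eventually.of_forall fun s => by simp only; field_simp)

lemma integral_partial_fst_siteLaw {h h' : ℝ × ℝ → ℝ}
    (hh : ∀ s p, HasDerivAt (fun s => h (s, p)) (h' (s, p)) s)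
    (i0 : Integrable h M.siteLaw) (i1 : Integrable h' M.siteLaw)
    (i2 : Integrable (fun z => h z * (deriv M.V z.1 - M.τ)) M.siteLaw) :
    M.T * ∫ z, h' z ∂M.siteLaw = ∫ z, h z * (deriv M.V z.1 - M.τ) ∂M.siteLaw := by
  unfold siteLaw at *
  rw [integral_prod_symm _ i1, integral_prod_symm _ i2, ← integral_const_mul]
  refine integral_congr_ae ?_
  filter_upwards [i0.prod_left_ae, i1.prod_left_ae, i2.prod_left_ae] with p h0 h1 h2
  exact integral_deriv_rLaw (fun s => hh s p) h0 h1 h2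

lemma integral_partial_snd_siteLaw {h h' : ℝ × ℝ → ℝ}
    (hh : ∀ r s, HasDerivAt (fun s => h (r, s)) (h' (r, s)) s)
    (i0 : Integrable h M.siteLaw) (i1 : Integrable h' M.siteLaw)
    (i2 : Integrable (fun z => h z * z.2) M.siteLaw) :
    M.T * ∫ z, h' z ∂M.siteLaw = ∫ z, h z * z.2 ∂M.siteLaw := by
  unfold siteLaw at *
  rw [integral_prod _ i1, integral_prod _ i2, ← integral_const_mul]
  refine integral_congr_ae ?_
  filter_upwards [i0.prod_right_ae, i1.prod_right_ae, i2.prod_right_ae] with r h0 h1 h2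
  exact integral_deriv_gaussian (fun s => hh r s) h0 h1 h2

variable (M) in
/-- Resampling one site preserves the Gibbs measure. -/
lemma measurePreserving_update (x : ℤ) :
    MeasurePreserving (fun q : Config × (ℝ × ℝ) => Function.update q.1 x q.2)
      (M.gibbs.prod M.siteLaw) M.gibbs := by
  refine ⟨measurable_update', Measure.eq_infinitePi _ fun s t ht => ?_⟩
  rw [Measure.map_apply measurable_update' (MeasurableSet.pi s.countable_toSet fun i _ => ht i)]
  by_cases hx : x ∈ s
  · have e : (fun q : Config × (ℝ × ℝ) => Function.update q.1 x q.2) ⁻¹' ((s : Set ℤ).pi t) =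
        (((s.erase x : Finset ℤ) : Set ℤ).pi t) ×ˢ (t x) := by
      ext q
      simp only [Set.mem_preimage, Set.mem_pi, Set.mem_prod, Finset.coe_erase, Set.mem_sdiff,
        Set.mem_singleton_iff, Finset.mem_coe]
      constructor
      · refine fun h => ⟨fun i hi => ?_, ?_⟩
        · simpa [hi.2] using h i hi.1
        · simpa using h x hx
      · rintro ⟨h1, h2⟩ i hi
        by_cases hix : i = x
        · subst hix; simpa using h2
        · simpa [hix] using h1 i ⟨hi, hix⟩
    rw [e, Measure.prod_prod, gibbs, Measure.infinitePi_pi _ fun i _ => ht i,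
      Finset.prod_erase_mul _ _ hx]
  · have e : (fun q : Config × (ℝ × ℝ) => Function.update q.1 x q.2) ⁻¹' ((s : Set ℤ).pi t) =
        ((s : Set ℤ).pi t) ×ˢ Set.univ := by
      ext q
      simp only [Set.mem_preimage, Set.mem_pi, Set.mem_prod, Finset.mem_coe, Set.mem_univ,
        and_true]
      refine forall₂_congr fun i hi => ?_
      rw [Function.update_of_ne (ne_of_mem_of_not_mem hi hx)]
    rw [e, Measure.prod_prod, gibbs, Measure.infinitePi_pi _ fun i _ => ht i, measure_univ,
      mul_one]

/-- Independence of the sites allows the coordinate at `x` to be integrated first, which reduces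
identities in infinite volume to identities for `siteLaw`. -/
lemma integral_resample {F : Config → ℝ} (hF : Integrable F M.gibbs) (x : ℤ) :
    ∫ η, F η ∂M.gibbs = ∫ η, ∫ z, F (Function.update η x z) ∂M.siteLaw ∂M.gibbs := by
  have hm := M.measurePreserving_update x
  have hF' : AEStronglyMeasurable F ((M.gibbs.prod M.siteLaw).map
      (fun q : Config × (ℝ × ℝ) => Function.update q.1 x q.2)) := by
    rw [hm.map_eq]; exact hF.1
  have h := integral_prod _ (hm.integrable_comp_of_integrable hF)
  simp only [Function.comp] at h
  rw [← h, ← integral_map hm.measurable.aemeasurable hF', hm.map_eq]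

lemma ae_integrable_resample {F : Config → ℝ} (hF : Integrable F M.gibbs) (x : ℤ) :
    ∀ᵐ η ∂M.gibbs, Integrable (fun z => F (Function.update η x z)) M.siteLaw :=
  ((M.measurePreserving_update x).integrable_comp_of_integrable hF).prod_right_ae

/-- Integration by parts in the distance `r_x`. -/
lemma integral_partialR {g : Config → ℝ} {x : ℤ}
    (hd : ∀ η, Differentiable ℝ fun s : ℝ => g (Function.update η x (s, (η x).2)))
    (i0 : Integrable g M.gibbs) (i1 : Integrable (partialR x g) M.gibbs)
    (i2 : Integrable (fun η => g η * (deriv M.V (η x).1 - M.τ)) M.gibbs) :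
    M.T * ∫ η, partialR x g η ∂M.gibbs = ∫ η, g η * (deriv M.V (η x).1 - M.τ) ∂M.gibbs := by
  rw [integral_resample i1 x, integral_resample i2 x, ← integral_const_mul]
  refine integral_congr_ae ?_
  filter_upwards [ae_integrable_resample i0 x, ae_integrable_resample i1 x,
    ae_integrable_resample i2 x] with η h0 h1 h2
  simp only [Function.update_self] at h2 ⊢
  refine integral_partial_fst_siteLaw (fun s p => ?_) h0 h1 h2
  -- `hd` freezes the momentum of its own configuration; evaluating it at the updated one makes that
  -- momentum the free variable `p`.
  have := (hd (Function.update η x (s, p)) s).hasDerivAt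
  simp only [Function.update_idem, Function.update_self] at this
  simpa only [partialR, Function.update_idem, Function.update_self] using this

/-- Integration by parts in the momentum `p_x`. -/
lemma integral_partialP {g : Config → ℝ} {x : ℤ}
    (hd : ∀ η, Differentiable ℝ fun s : ℝ => g (Function.update η x ((η x).1, s)))
    (i0 : Integrable g M.gibbs) (i1 : Integrable (partialP x g) M.gibbs)
    (i2 : Integrable (fun η => g η * (η x).2) M.gibbs) :
    M.T * ∫ η, partialP x g η ∂M.gibbs = ∫ η, g η * (η x).2 ∂M.gibbs := by
  rw [integral_resample i1 x, integral_resample i2 x, ← integral_const_mul]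
  refine integral_congr_ae ?_
  filter_upwards [ae_integrable_resample i0 x, ae_integrable_resample i1 x,
    ae_integrable_resample i2 x] with η h0 h1 h2
  simp only [Function.update_self] at h2 ⊢
  refine integral_partial_snd_siteLaw (fun r s => ?_) h0 h1 h2
  have := (hd (Function.update η x (r, s)) s).hasDerivAt
  simp only [Function.update_idem, Function.update_self] at this
  simpa only [partialP, Function.update_idem, Function.update_self] using this

/-! ### Velocity flips -/

lemma flip_apply (x z : ℤ) (η : Config) :
    flip x η z = if z = x then ((η z).1, -(η z).2) else η z := by
  by_cases h : z = x
  · subst h; simp [flip]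
  · simp [flip, h]

lemma flip_flip (x : ℤ) (η : Config) : flip x (flip x η) = η := by
  funext z
  by_cases h : z = x <;> simp [flip_apply, h]

lemma shift_flip (x y : ℤ) (η : Config) : shift x (flip y η) = flip (y - x) (shift x η) := by
  funext z
  have : (x + z = y) ↔ (z = y - x) := by omega
  simp [flip_apply, shift, this]

variable (M) in
-- The flip acts site by site, as the identity away from `x`, and the centered Gaussian is
-- symmetric.
lemma measurePreserving_flip (x : ℤ) : MeasurePreserving (flip x) M.gibbs M.gibbs := by
  have hs : MeasurePreserving (fun z : ℝ × ℝ => (z.1, -z.2)) M.siteLaw M.siteLaw :=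
    (MeasurePreserving.id M.rLaw).prod ⟨measurable_neg, by
      have := gaussianReal_map_neg (μ := 0) (v := M.T.toNNReal)
      simpa using this⟩
  set f : ℤ → ℝ × ℝ → ℝ × ℝ := fun z w => if z = x then (w.1, -w.2) else w with hf
  have hfm : ∀ z, MeasurePreserving (f z) M.siteLaw M.siteLaw := by
    intro z
    by_cases h : z = x
    · simpa only [hf, h, if_true] using hs
    · simp only [hf, h, if_false]
      exact MeasurePreserving.id M.siteLaw
  have e : flip x = fun η z => f z (η z) := by
    funext η z
    rw [flip_apply]
  rw [e]
  refine ⟨measurable_pi_lambda _ fun z => (hfm z).measurable.comp (measurable_pi_apply z), ?_⟩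
  have := Measure.infinitePi_map_pi (fun _ : ℤ => M.siteLaw) fun z => (hfm z).measurable
  simp only [(hfm _).map_eq] at this
  exact this

lemma integral_flip {F : Config → ℝ} (hF : Measurable F) (x : ℤ) :
    ∫ η, F (flip x η) ∂M.gibbs = ∫ η, F η ∂M.gibbs := by
  conv_rhs => rw [← (M.measurePreserving_flip x).map_eq]
  rw [integral_map (M.measurePreserving_flip x).measurable.aemeasurable hF.aestronglyMeasurable]

/-- Functions which are odd in one momentum have mean zero. -/
lemma integral_eq_zero_of_flip_odd {F : Config → ℝ} (hF : Measurable F) (x : ℤ)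
    (h : ∀ η, F (flip x η) = -F η) : ∫ η, F η ∂M.gibbs = 0 := by
  have := integral_flip (M := M) hF x
  simp only [h, integral_neg] at this
  linarith

/-! ### Bounded differentiable local functions and the Liouville operator -/

/-- Bounded local functions with bounded measurable partial derivatives. Unlike the compactly
supported local functions they are stable under sums. -/
structure IsSmoothLocal (f : Config → ℝ) : Prop where
  measurable : Measurable f
  dependsOn : ∃ Λ : Finset ℤ, DependsOn f (Λ : Set ℤ)
  bounded : ∃ C, ∀ η, |f η| ≤ C
  differentiableR : ∀ x η, Differentiable ℝ fun s : ℝ => f (Function.update η x (s, (η x).2))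
  differentiableP : ∀ x η, Differentiable ℝ fun s : ℝ => f (Function.update η x ((η x).1, s))
  measurable_partialR : ∀ x, Measurable (partialR x f)
  measurable_partialP : ∀ x, Measurable (partialP x f)
  bounded_partialR : ∀ x, ∃ C, ∀ η, |partialR x f η| ≤ C
  bounded_partialP : ∀ x, ∃ C, ∀ η, |partialP x f η| ≤ C

/-! ### Locality and translation of partial derivatives. -/

lemma update_fst_self (x : ℤ) (η : Config) :
    Function.update η x ((η x).1, (η x).2) = η := Function.update_eq_self x η

lemma shift_update (x y : ℤ) (z : ℝ × ℝ) (η : Config) :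
    shift x (Function.update η y z) = Function.update (shift x η) (y - x) z := by
  funext w
  by_cases h : w = y - x
  · subst h; simp [shift]
  · have : x + w ≠ y := by omega
    simp [shift, h, this]

lemma shift_apply_sub (x y : ℤ) (η : Config) : shift x η (y - x) = η y := by
  simp [shift]

lemma partialR_shift (x y : ℤ) (f : Config → ℝ) (η : Config) :
    partialR y (fun η => f (shift x η)) η = partialR (y - x) f (shift x η) := by
  simp only [partialR, shift_update, shift_apply_sub]

lemma partialP_shift (x y : ℤ) (f : Config → ℝ) (η : Config) :
    partialP y (fun η => f (shift x η)) η = partialP (y - x) f (shift x η) := by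
  simp only [partialP, shift_update, shift_apply_sub]

lemma update_eqOn_of_notMem {Λ : Set ℤ} {f : Config → ℝ} (hf : DependsOn f Λ) {x : ℤ}
    (hx : x ∉ Λ) (η : Config) (z : ℝ × ℝ) : f (Function.update η x z) = f η :=
  hf fun i hi => by rw [Function.update_of_ne (ne_of_mem_of_not_mem hi hx)]

lemma partialR_eq_zero {Λ : Set ℤ} {f : Config → ℝ} (hf : DependsOn f Λ) {x : ℤ}
    (hx : x ∉ Λ) (η : Config) : partialR x f η = 0 := by
  simp only [partialR, update_eqOn_of_notMem hf hx, deriv_const]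

lemma partialP_eq_zero {Λ : Set ℤ} {f : Config → ℝ} (hf : DependsOn f Λ) {x : ℤ}
    (hx : x ∉ Λ) (η : Config) : partialP x f η = 0 := by
  simp only [partialP, update_eqOn_of_notMem hf hx, deriv_const]

lemma update_eqOn {Λ : Set ℤ} {η ζ : Config} (h : ∀ i ∈ Λ, η i = ζ i) (x : ℤ) (z : ℝ × ℝ) :
    ∀ i ∈ Λ, Function.update η x z i = Function.update ζ x z i := by
  intro i hi
  by_cases hx : i = x
  · subst hx; simp
  · simp [hx, h i hi]

lemma dependsOn_partialR {Λ : Set ℤ} {f : Config → ℝ} (hf : DependsOn f Λ) (x : ℤ) :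
    DependsOn (partialR x f) Λ := by
  intro η ζ h
  by_cases hx : x ∈ Λ
  · simp only [partialR, h x hx]
    congr 1
    funext s
    exact hf (update_eqOn h x _)
  · rw [partialR_eq_zero hf hx, partialR_eq_zero hf hx]

lemma dependsOn_partialP {Λ : Set ℤ} {f : Config → ℝ} (hf : DependsOn f Λ) (x : ℤ) :
    DependsOn (partialP x f) Λ := by
  intro η ζ h
  by_cases hx : x ∈ Λ
  · simp only [partialP, h x hx]
    congr 1
    funext s
    exact hf (update_eqOn h x _)
  · rw [partialP_eq_zero hf hx, partialP_eq_zero hf hx]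

lemma dependsOn_shift {Λ : Finset ℤ} {f : Config → ℝ} (hf : DependsOn f (Λ : Set ℤ)) (x : ℤ) :
    DependsOn (fun η => f (shift x η)) ((Λ.image fun z => x + z : Finset ℤ) : Set ℤ) := by
  intro η ζ h
  refine hf fun i hi => h (x + i) ?_
  simp only [Finset.coe_image]
  exact ⟨i, hi, rfl⟩

/-! ### The algebra of bounded differentiable local functions. -/

namespace IsSmoothLocal

variable {f g : Config → ℝ}

lemma partialR_add (hf : IsSmoothLocal f) (hg : IsSmoothLocal g) (x : ℤ) (η : Config) :
    partialR x (f + g) η = partialR x f η + partialR x g η :=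
  deriv_add (hf.differentiableR x η _) (hg.differentiableR x η _)

lemma partialP_add (hf : IsSmoothLocal f) (hg : IsSmoothLocal g) (x : ℤ) (η : Config) :
    partialP x (f + g) η = partialP x f η + partialP x g η :=
  deriv_add (hf.differentiableP x η _) (hg.differentiableP x η _)

lemma partialR_smul (hf : IsSmoothLocal f) (c : ℝ) (x : ℤ) (η : Config) :
    partialR x (c • f) η = c * partialR x f η :=
  deriv_const_mul c (hf.differentiableR x η _)

lemma partialP_smul (hf : IsSmoothLocal f) (c : ℝ) (x : ℤ) (η : Config) :
    partialP x (c • f) η = c * partialP x f η :=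
  deriv_const_mul c (hf.differentiableP x η _)

lemma partialR_mul (hf : IsSmoothLocal f) (hg : IsSmoothLocal g) (x : ℤ) (η : Config) :
    partialR x (f * g) η = partialR x f η * g η + f η * partialR x g η := by
  have h := deriv_mul (hf.differentiableR x η (η x).1) (hg.differentiableR x η (η x).1)
  simp only [update_fst_self] at h
  exact h

lemma partialP_mul (hf : IsSmoothLocal f) (hg : IsSmoothLocal g) (x : ℤ) (η : Config) :
    partialP x (f * g) η = partialP x f η * g η + f η * partialP x g η := by
  have h := deriv_mul (hf.differentiableP x η (η x).2) (hg.differentiableP x η (η x).2)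
  simp only [update_fst_self] at h
  exact h

lemma exists_bound_add {u v : Config → ℝ} (hu : ∃ C, ∀ η, |u η| ≤ C) (hv : ∃ C, ∀ η, |v η| ≤ C) :
    ∃ C, ∀ η, |u η + v η| ≤ C := by
  obtain ⟨C, hC⟩ := hu
  obtain ⟨D, hD⟩ := hv
  exact ⟨C + D, fun η => (abs_add_le _ _).trans (add_le_add (hC η) (hD η))⟩

lemma exists_bound_mul {u v : Config → ℝ} (hu : ∃ C, ∀ η, |u η| ≤ C) (hv : ∃ C, ∀ η, |v η| ≤ C) :
    ∃ C, ∀ η, |u η * v η| ≤ C := by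
  obtain ⟨C, hC⟩ := hu
  obtain ⟨D, hD⟩ := hv
  refine ⟨C * D, fun η => ?_⟩
  rw [abs_mul]
  exact mul_le_mul (hC η) (hD η) (abs_nonneg _) ((abs_nonneg _).trans (hC η))

lemma exists_dependsOn (hf : IsSmoothLocal f) (hg : IsSmoothLocal g) :
    ∃ Λ : Finset ℤ, DependsOn f (Λ : Set ℤ) ∧ DependsOn g (Λ : Set ℤ) := by
  obtain ⟨S, hS⟩ := hf.dependsOn
  obtain ⟨R, hR⟩ := hg.dependsOn
  exact ⟨S ∪ R, hS.mono (by simp), hR.mono (by simp)⟩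

lemma add (hf : IsSmoothLocal f) (hg : IsSmoothLocal g) : IsSmoothLocal (f + g) where
  measurable := hf.measurable.add hg.measurable
  dependsOn := by
    obtain ⟨Λ, h1, h2⟩ := hf.exists_dependsOn hg
    exact ⟨Λ, fun η ζ h => by simp only [Pi.add_apply, h1 h, h2 h]⟩
  bounded := exists_bound_add hf.bounded hg.bounded
  differentiableR x η := (hf.differentiableR x η).add (hg.differentiableR x η)
  differentiableP x η := (hf.differentiableP x η).add (hg.differentiableP x η)
  measurable_partialR x := by
    simp only [funext (hf.partialR_add hg x)]
    exact (hf.measurable_partialR x).add (hg.measurable_partialR x)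
  measurable_partialP x := by
    simp only [funext (hf.partialP_add hg x)]
    exact (hf.measurable_partialP x).add (hg.measurable_partialP x)
  bounded_partialR x := by
    simp only [hf.partialR_add hg x]
    exact exists_bound_add (hf.bounded_partialR x) (hg.bounded_partialR x)
  bounded_partialP x := by
    simp only [hf.partialP_add hg x]
    exact exists_bound_add (hf.bounded_partialP x) (hg.bounded_partialP x)

lemma smul (hf : IsSmoothLocal f) (c : ℝ) : IsSmoothLocal (c • f) where
  measurable := hf.measurable.const_smul c
  dependsOn := by
    obtain ⟨Λ, h1⟩ := hf.dependsOn
    exact ⟨Λ, fun η ζ h => by simp only [Pi.smul_apply, h1 h]⟩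
  bounded := exists_bound_mul (u := fun _ => c) ⟨|c|, fun _ => le_rfl⟩ hf.bounded
  differentiableR x η := (hf.differentiableR x η).const_smul c
  differentiableP x η := (hf.differentiableP x η).const_smul c
  measurable_partialR x := by
    simp only [funext (hf.partialR_smul c x)]
    exact (hf.measurable_partialR x).const_mul c
  measurable_partialP x := by
    simp only [funext (hf.partialP_smul c x)]
    exact (hf.measurable_partialP x).const_mul c
  bounded_partialR x := by
    simp only [hf.partialR_smul c x]
    exact exists_bound_mul (u := fun _ => c) ⟨|c|, fun _ => le_rfl⟩ (hf.bounded_partialR x)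
  bounded_partialP x := by
    simp only [hf.partialP_smul c x]
    exact exists_bound_mul (u := fun _ => c) ⟨|c|, fun _ => le_rfl⟩ (hf.bounded_partialP x)

/-- Products f · θ_x h enter the antisymmetry of the Liouville operator, whence the need for
stability under products and shifts. -/
lemma mul (hf : IsSmoothLocal f) (hg : IsSmoothLocal g) : IsSmoothLocal (f * g) where
  measurable := hf.measurable.mul hg.measurable
  dependsOn := by
    obtain ⟨Λ, h1, h2⟩ := hf.exists_dependsOn hg
    exact ⟨Λ, fun η ζ h => by simp only [Pi.mul_apply, h1 h, h2 h]⟩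
  bounded := exists_bound_mul hf.bounded hg.bounded
  differentiableR x η := (hf.differentiableR x η).mul (hg.differentiableR x η)
  differentiableP x η := (hf.differentiableP x η).mul (hg.differentiableP x η)
  measurable_partialR x := by
    simp only [funext (hf.partialR_mul hg x)]
    exact ((hf.measurable_partialR x).mul hg.measurable).add
      (hf.measurable.mul (hg.measurable_partialR x))
  measurable_partialP x := by
    simp only [funext (hf.partialP_mul hg x)]
    exact ((hf.measurable_partialP x).mul hg.measurable).add
      (hf.measurable.mul (hg.measurable_partialP x))
  bounded_partialR x := by
    simp only [hf.partialR_mul hg x]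
    exact exists_bound_add (exists_bound_mul (hf.bounded_partialR x) hg.bounded)
      (exists_bound_mul hf.bounded (hg.bounded_partialR x))
  bounded_partialP x := by
    simp only [hf.partialP_mul hg x]
    exact exists_bound_add (exists_bound_mul (hf.bounded_partialP x) hg.bounded)
      (exists_bound_mul hf.bounded (hg.bounded_partialP x))

lemma comp_shift (hf : IsSmoothLocal f) (x : ℤ) : IsSmoothLocal fun η => f (shift x η) where
  measurable := hf.measurable.comp (measurable_shift x)
  dependsOn := by
    obtain ⟨Λ, h1⟩ := hf.dependsOn
    exact ⟨_, dependsOn_shift h1 x⟩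
  bounded := hf.bounded.imp fun C hC η => hC _
  differentiableR y η := by
    have := hf.differentiableR (y - x) (shift x η)
    simpa only [shift_update, shift_apply_sub] using this
  differentiableP y η := by
    have := hf.differentiableP (y - x) (shift x η)
    simpa only [shift_update, shift_apply_sub] using this
  measurable_partialR y := by
    simp only [funext (partialR_shift x y f)]
    exact (hf.measurable_partialR (y - x)).comp (measurable_shift x)
  measurable_partialP y := by
    simp only [funext (partialP_shift x y f)]
    exact (hf.measurable_partialP (y - x)).comp (measurable_shift x)
  bounded_partialR y := by
    simp only [partialR_shift x y f]
    exact (hf.bounded_partialR (y - x)).imp fun C hC η => hC _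
  bounded_partialP y := by
    simp only [partialP_shift x y f]
    exact (hf.bounded_partialP (y - x)).imp fun C hC η => hC _

end IsSmoothLocal

lemma IsLocalTest.isSmoothLocal {f : Config → ℝ} (hf : IsLocalTest f) : IsSmoothLocal f := by
  obtain ⟨Λ, φ, hφ, hc, hfφ⟩ := hf
  set res : Config → (Λ → ℝ × ℝ) := fun η x => η x with hres
  have hresm : Measurable res := measurable_pi_lambda _ fun x => measurable_pi_apply (x : ℤ)
  have hfe : f = fun η => φ (res η) := funext hfφ
  have hd : Differentiable ℝ φ := hφ.differentiable (by norm_num)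
  -- One chain rule formula covers all sites: for `x ∉ Λ` the direction vector is zero.
  have hderR : ∀ (x : ℤ) (η : Config) (s : ℝ),
      HasDerivAt (fun s : ℝ => f (Function.update η x (s, (η x).2)))
        (fderiv ℝ φ (res (Function.update η x (s, (η x).2)))
          (fun y : Λ => if (y : ℤ) = x then (1, 0) else 0)) s := by
    intro x η s
    rw [hfe]
    refine (hd _).hasFDerivAt.comp_hasDerivAt s (hasDerivAt_pi.2 fun y => ?_)
    by_cases hy : (y : ℤ) = x
    · simp only [hres, hy, Function.update_self, if_true]
      exact (hasDerivAt_id s).prodMk (hasDerivAt_const s _)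
    · simp only [hres, hy, Function.update_of_ne, if_false, ne_eq, not_false_eq_true]
      exact hasDerivAt_const s _
  have hderP : ∀ (x : ℤ) (η : Config) (s : ℝ),
      HasDerivAt (fun s : ℝ => f (Function.update η x ((η x).1, s)))
        (fderiv ℝ φ (res (Function.update η x ((η x).1, s)))
          (fun y : Λ => if (y : ℤ) = x then (0, 1) else 0)) s := by
    intro x η s
    rw [hfe]
    refine (hd _).hasFDerivAt.comp_hasDerivAt s (hasDerivAt_pi.2 fun y => ?_)
    by_cases hy : (y : ℤ) = x
    · simp only [hres, hy, Function.update_self, if_true]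
      exact (hasDerivAt_const s _).prodMk (hasDerivAt_id s)
    · simp only [hres, hy, Function.update_of_ne, if_false, ne_eq, not_false_eq_true]
      exact hasDerivAt_const s _
  have eR : ∀ x, partialR x f = fun η => fderiv ℝ φ (res η)
      (fun y : Λ => if (y : ℤ) = x then (1, 0) else 0) := fun x => funext fun η => by
    rw [partialR, (hderR x η _).deriv, update_fst_self]
  have eP : ∀ x, partialP x f = fun η => fderiv ℝ φ (res η)
      (fun y : Λ => if (y : ℤ) = x then (0, 1) else 0) := fun x => funext fun η => by
    rw [partialP, (hderP x η _).deriv, update_fst_self]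
  have hcd : Continuous (fderiv ℝ φ) := hφ.continuous_fderiv (by norm_num)
  have hm : ∀ v : Λ → ℝ × ℝ, Measurable fun η : Config => fderiv ℝ φ (res η) v := fun v =>
    ((hcd.clm_apply continuous_const).measurable).comp hresm
  obtain ⟨C, hC⟩ := hcd.bounded_above_of_compact_support (hc.fderiv ℝ)
  have hb : ∀ v : Λ → ℝ × ℝ, ∃ C, ∀ η : Config, |fderiv ℝ φ (res η) v| ≤ C := fun v =>
    ⟨C * ‖v‖, fun η => ((fderiv ℝ φ (res η)).le_opNorm v).trans
      (mul_le_mul_of_nonneg_right (hC _) (norm_nonneg _))⟩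
  refine ⟨?_, ⟨Λ, ?_⟩, ?_, fun x η s => (hderR x η s).differentiableAt,
    fun x η s => (hderP x η s).differentiableAt, fun x => ?_, fun x => ?_, fun x => ?_,
    fun x => ?_⟩
  · rw [hfe]; exact hφ.continuous.measurable.comp hresm
  · intro η ζ h
    rw [hfφ, hfφ]
    congr 1
    funext y
    exact h y y.2
  · obtain ⟨D, hD⟩ := hφ.continuous.bounded_above_of_compact_support hc
    exact ⟨D, fun η => by rw [hfφ]; exact hD _⟩
  · rw [eR]; exact hm _
  · rw [eP]; exact hm _
  · simp only [eR]; exact hb _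
  · simp only [eP]; exact hb _

/-- The freedom to enlarge `Λ` to `S` allows summation over an interval, where the integrated terms
telescope. -/
lemma liouville_eq_sum {f : Config → ℝ} {Λ : Finset ℤ} (hf : DependsOn f (Λ : Set ℤ))
    {S : Finset ℤ} (hS : Λ ⊆ S) (η : Config) :
    M.liouville f η = ∑ x ∈ S, (((η x).2 - (η (x - 1)).2) * partialR x f η
      + (deriv M.V (η (x + 1)).1 - deriv M.V (η x).1) * partialP x f η) := by
  refine finsum_eq_sum_of_support_subset _ fun x hx => ?_
  by_contra hn
  refine hx ?_
  have hxΛ : x ∉ (Λ : Set ℤ) := fun h => hn (hS h)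
  simp only [partialR_eq_zero hf hxΛ, partialP_eq_zero hf hxΛ, mul_zero, add_zero]

lemma liouville_shift (f : Config → ℝ) (x : ℤ) (η : Config) :
    M.liouville (fun η => f (shift x η)) η = M.liouville f (shift x η) := by
  unfold liouville
  rw [← finsum_comp_equiv (Equiv.addLeft x)]
  refine finsum_congr fun y => ?_
  have e1 : x + y - x = y := by ring
  simp only [partialR_shift, partialP_shift, Equiv.coe_addLeft, e1, shift, add_assoc, add_sub_assoc]

/-! ### The Liouville operator as a derivation. -/

namespace IsSmoothLocal

variable {f g : Config → ℝ}

lemma liouville_add (hf : IsSmoothLocal f) (hg : IsSmoothLocal g) (η : Config) :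
    M.liouville (f + g) η = M.liouville f η + M.liouville g η := by
  obtain ⟨Λ, h1, h2⟩ := hf.exists_dependsOn hg
  have h3 : DependsOn (f + g) (Λ : Set ℤ) := fun η ζ h => by simp only [Pi.add_apply, h1 h, h2 h]
  rw [liouville_eq_sum h1 le_rfl, liouville_eq_sum h2 le_rfl, liouville_eq_sum h3 le_rfl,
    ← Finset.sum_add_distrib]
  refine Finset.sum_congr rfl fun x _ => ?_
  rw [hf.partialR_add hg, hf.partialP_add hg]
  ring

lemma liouville_smul (hf : IsSmoothLocal f) (c : ℝ) (η : Config) :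
    M.liouville (c • f) η = c * M.liouville f η := by
  obtain ⟨Λ, h1⟩ := hf.dependsOn
  have h3 : DependsOn (c • f) (Λ : Set ℤ) := fun η ζ h => by simp only [Pi.smul_apply, h1 h]
  rw [liouville_eq_sum h1 le_rfl, liouville_eq_sum h3 le_rfl, Finset.mul_sum]
  refine Finset.sum_congr rfl fun x _ => ?_
  rw [hf.partialR_smul, hf.partialP_smul]
  ring

lemma liouville_mul (hf : IsSmoothLocal f) (hg : IsSmoothLocal g) (η : Config) :
    M.liouville (f * g) η = M.liouville f η * g η + f η * M.liouville g η := by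
  obtain ⟨Λ, h1, h2⟩ := hf.exists_dependsOn hg
  have h3 : DependsOn (f * g) (Λ : Set ℤ) := fun η ζ h => by simp only [Pi.mul_apply, h1 h, h2 h]
  rw [liouville_eq_sum h1 le_rfl, liouville_eq_sum h2 le_rfl, liouville_eq_sum h3 le_rfl,
    Finset.sum_mul, Finset.mul_sum, ← Finset.sum_add_distrib]
  refine Finset.sum_congr rfl fun x _ => ?_
  rw [hf.partialR_mul hg, hf.partialP_mul hg]
  ring

lemma memLp (hf : IsSmoothLocal f) (q : ℝ≥0∞) : MemLp f q M.gibbs := by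
  obtain ⟨C, hC⟩ := hf.bounded
  exact MemLp.of_bound hf.measurable.aestronglyMeasurable C (Eventually.of_forall hC)

end IsSmoothLocal

variable (M) in
lemma memLp_deriv_V_two (x : ℤ) : MemLp (fun η : Config => deriv M.V (η x).1) 2 M.gibbs :=
  (M.memLp_deriv_V x).mono_exponent (by norm_num)

variable (M) in
lemma memLp_p_sub (x y : ℤ) : MemLp (fun η : Config => (η x).2 - (η y).2) 2 M.gibbs :=
  (M.memLp_p x 2 (by norm_num)).sub (M.memLp_p y 2 (by norm_num))

variable (M) in
lemma memLp_deriv_V_sub (x y : ℤ) :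
    MemLp (fun η : Config => deriv M.V (η x).1 - deriv M.V (η y).1) 2 M.gibbs :=
  (M.memLp_deriv_V_two x).sub (M.memLp_deriv_V_two y)

lemma memLp_mul_of_bounded {u v : Config → ℝ} (hu : MemLp u 2 M.gibbs) (hv : Measurable v)
    (hb : ∃ C, ∀ η, |v η| ≤ C) : MemLp (fun η => u η * v η) 2 M.gibbs := by
  obtain ⟨C, hC⟩ := hb
  refine hu.of_le_mul (c := C) (hu.1.mul hv.aestronglyMeasurable) (Eventually.of_forall fun η => ?_)
  rw [norm_mul, mul_comm]
  exact mul_le_mul_of_nonneg_right (hC η) (norm_nonneg _)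

lemma integrable_mul_of_bounded {u v : Config → ℝ} (hu : Integrable u M.gibbs) (hv : Measurable v)
    (hb : ∃ C, ∀ η, |v η| ≤ C) : Integrable (fun η => v η * u η) M.gibbs := by
  obtain ⟨C, hC⟩ := hb
  exact hu.bdd_mul hv.aestronglyMeasurable (Eventually.of_forall hC)

lemma measurable_deriv_V (x : ℤ) : Measurable fun η : Config => deriv M.V (η x).1 :=
  M.continuous_deriv_V.measurable.comp (measurable_fst.comp (measurable_pi_apply x))

lemma IsSmoothLocal.liouville_mem {f : Config → ℝ} (hf : IsSmoothLocal f) :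
    M.liouville f ∈ M.localSubmodule := by
  obtain ⟨Λ, hΛ⟩ := hf.dependsOn
  have e : M.liouville f = fun η => ∑ x ∈ Λ, (((η x).2 - (η (x - 1)).2) * partialR x f η
      + (deriv M.V (η (x + 1)).1 - deriv M.V (η x).1) * partialP x f η) :=
    funext fun η => liouville_eq_sum hΛ le_rfl η
  -- The coefficients involve p_{x-1} and r_{x+1}, so the support grows by one site on each side.
  refine ⟨?_, ⟨Λ ∪ Λ.image (fun x => x - 1) ∪ Λ.image (fun x => x + 1), fun η ζ h => ?_⟩, ?_⟩
  · rw [e]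
    refine Finset.measurable_sum _ fun x _ => ?_
    have h1 := hf.measurable_partialR x
    have h2 := hf.measurable_partialP x
    have h3 := measurable_deriv_V (M := M) (x + 1)
    have h4 := measurable_deriv_V (M := M) x
    fun_prop
  · rw [e]
    refine Finset.sum_congr rfl fun x hx => ?_
    have h' : ∀ i ∈ (Λ : Set ℤ), η i = ζ i := fun i hi => h i (by simp at hi ⊢; tauto)
    rw [dependsOn_partialR hΛ x h', dependsOn_partialP hΛ x h', h x (by simp; tauto),
      h (x - 1) (by simp [hx]), h (x + 1) (by simp [hx])]
  · rw [e]
    refine memLp_finsetSum _ fun x _ => ?_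
    exact (memLp_mul_of_bounded (M.memLp_p_sub _ _) (hf.measurable_partialR x)
      (hf.bounded_partialR x)).add (memLp_mul_of_bounded (M.memLp_deriv_V_sub _ _)
      (hf.measurable_partialP x) (hf.bounded_partialP x))

/-- One term of the Liouville operator, integrated by parts. -/
lemma IsSmoothLocal.integral_liouville_term {f : Config → ℝ} (hf : IsSmoothLocal f) (x : ℤ) :
    M.T * ∫ η, (((η x).2 - (η (x - 1)).2) * partialR x f η
      + (deriv M.V (η (x + 1)).1 - deriv M.V (η x).1) * partialP x f η) ∂M.gibbs =
    ∫ η, (f η * ((deriv M.V (η (x + 1)).1 - M.τ) * (η x).2)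
      - f η * ((deriv M.V (η x).1 - M.τ) * (η (x - 1)).2)) ∂M.gibbs := by
  have hx1 : x - 1 ≠ x := by omega
  have hx2 : x + 1 ≠ x := by omega
  -- The coefficient of ∂_{r_x} does not contain r_x, nor that of ∂_{p_x} the variable p_x, so both
  -- pass inside the derivative.
  have hR : ∀ η, partialR x (fun η => ((η x).2 - (η (x - 1)).2) * f η) η =
      ((η x).2 - (η (x - 1)).2) * partialR x f η := by
    intro η
    simp only [partialR, Function.update_self, Function.update_of_ne hx1]
    exact deriv_const_mul _ (hf.differentiableR x η _)
  have hP : ∀ η, partialP x (fun η => (deriv M.V (η (x + 1)).1 - deriv M.V (η x).1) * f η) η =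
      (deriv M.V (η (x + 1)).1 - deriv M.V (η x).1) * partialP x f η := by
    intro η
    simp only [partialP, Function.update_self, Function.update_of_ne hx2]
    exact deriv_const_mul _ (hf.differentiableP x η _)
  have iR := memLp_mul_of_bounded (M.memLp_p_sub x (x - 1)) (hf.measurable_partialR x)
    (hf.bounded_partialR x)
  have iP := memLp_mul_of_bounded (M.memLp_deriv_V_sub (x + 1) x) (hf.measurable_partialP x)
    (hf.bounded_partialP x)
  have jR := integrable_mul_of_bounded ((M.memLp_p_sub x (x - 1)).integrable_mul
    ((M.memLp_deriv_V_two x).sub (memLp_const M.τ))) hf.measurable hf.bounded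
  have jP := integrable_mul_of_bounded ((M.memLp_deriv_V_sub (x + 1) x).integrable_mul
    (M.memLp_p x 2 (by norm_num))) hf.measurable hf.bounded
  simp only [Pi.mul_apply, Pi.sub_apply] at jR jP
  have kR := integral_partialR (M := M) (x := x)
    (g := fun η => ((η x).2 - (η (x - 1)).2) * f η)
    (fun η => by
      simp only [Function.update_self, Function.update_of_ne hx1]
      exact (hf.differentiableR x η).const_mul _)
    ((memLp_mul_of_bounded (M.memLp_p_sub x (x - 1)) hf.measurable hf.bounded).integrable
      (by norm_num))
    (by rw [funext hR]; exact iR.integrable (by norm_num))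
    (jR.congr (Eventually.of_forall fun η => by simp only; ring))
  have kP := integral_partialP (M := M) (x := x)
    (g := fun η => (deriv M.V (η (x + 1)).1 - deriv M.V (η x).1) * f η)
    (fun η => by
      simp only [Function.update_self, Function.update_of_ne hx2]
      exact (hf.differentiableP x η).const_mul _)
    ((memLp_mul_of_bounded (M.memLp_deriv_V_sub (x + 1) x) hf.measurable hf.bounded).integrable
      (by norm_num))
    (by rw [funext hP]; exact iP.integrable (by norm_num))
    (jP.congr (Eventually.of_forall fun η => by simp only; ring))
  simp only [hR] at kR
  simp only [hP] at kP
  rw [integral_add (iR.integrable (by norm_num)) (iP.integrable (by norm_num)), mul_add, kR, kP,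
    ← integral_add (jR.congr (Eventually.of_forall fun η => by simp only; ring))
      (jP.congr (Eventually.of_forall fun η => by simp only; ring))]
  -- The products p_x V'(r_x) cancel, leaving a discrete gradient of p_{x-1}(V'(r_x) - τ), weighted
  -- by `f`.
  exact integral_congr_ae (Eventually.of_forall fun η => by simp only; ring)

/-- The Gibbs measure is invariant for the Liouville operator. -/
lemma IsSmoothLocal.integral_liouville {f : Config → ℝ} (hf : IsSmoothLocal f) :
    ∫ η, M.liouville f η ∂M.gibbs = 0 := by
  obtain ⟨Λ, hΛ⟩ := hf.dependsOn
  -- The sum over [-N, N-1] telescopes to boundary terms carrying p_{N-1} and p_{-N-1}. The margin 2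
  -- puts the site N-1 outside `Λ`.
  obtain ⟨N, hN⟩ : ∃ N : ℕ, ∀ x ∈ Λ, x.natAbs + 2 ≤ N :=
    ⟨Λ.sup fun x => x.natAbs + 2, fun x hx => Finset.le_sup (f := fun x => x.natAbs + 2) hx⟩
  set e : ℕ → ℤ := fun i => -(N : ℤ) + i with he
  have hinj : Function.Injective e := fun i j h => by simp only [he] at h; omega
  have hsub : Λ ⊆ (Finset.range (2 * N)).image e := by
    intro x hx
    have := hN x hx
    refine Finset.mem_image.2 ⟨(x + N).toNat, ?_, ?_⟩
    · simp only [Finset.mem_range]; omega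
    · simp only [he]; omega
  have hi : ∀ x : ℤ, Integrable (fun η => (((η x).2 - (η (x - 1)).2) * partialR x f η
      + (deriv M.V (η (x + 1)).1 - deriv M.V (η x).1) * partialP x f η)) M.gibbs := fun x =>
    ((memLp_mul_of_bounded (M.memLp_p_sub x (x - 1)) (hf.measurable_partialR x)
      (hf.bounded_partialR x)).add (memLp_mul_of_bounded (M.memLp_deriv_V_sub (x + 1) x)
      (hf.measurable_partialP x) (hf.bounded_partialP x))).integrable (by norm_num)
  set c : ℕ → Config → ℝ := fun i η =>
    f η * ((deriv M.V (η (e i)).1 - M.τ) * (η (e i - 1)).2) with hc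
  have hci : ∀ i, Integrable (c i) M.gibbs := fun i =>
    integrable_mul_of_bounded (((M.memLp_deriv_V_two (e i)).sub (memLp_const M.τ)).integrable_mul
      (M.memLp_p (e i - 1) 2 (by norm_num))) hf.measurable hf.bounded
  -- A boundary term is odd in a momentum on which `f` does not depend.
  have hc0 : ∀ i, e i - 1 ∉ Λ → ∫ η, c i η ∂M.gibbs = 0 := by
    intro i hi
    refine integral_eq_zero_of_flip_odd ?_ (e i - 1) fun η => ?_
    · have h1 := hf.measurable
      have h2 := measurable_deriv_V (M := M) (e i)
      fun_prop
    · have hne : e i ≠ e i - 1 := by omega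
      have hfl : f (flip (e i - 1) η) = f η := update_eqOn_of_notMem hΛ (by simpa using hi) η _
      simp only [hc, hfl, flip_apply, hne, if_false, if_true]
      ring
  have hterm : ∀ i, M.T * ∫ η, (((η (e i)).2 - (η (e i - 1)).2) * partialR (e i) f η
      + (deriv M.V (η (e i + 1)).1 - deriv M.V (η (e i)).1) * partialP (e i) f η) ∂M.gibbs =
      (∫ η, c (i + 1) η ∂M.gibbs) - ∫ η, c i η ∂M.gibbs := by
    intro i
    rw [hf.integral_liouville_term, ← integral_sub (hci _) (hci _)]
    have e1 : e (i + 1) = e i + 1 := by simp only [he]; push_cast; ring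
    have e2 : e i + 1 - 1 = e i := by ring
    simp only [hc, e1, e2]
  have hsum : M.T * ∫ η, M.liouville f η ∂M.gibbs = 0 := by
    simp only [liouville_eq_sum hΛ hsub, Finset.sum_image hinj.injOn]
    rw [integral_finsetSum _ fun i _ => hi (e i), Finset.mul_sum,
      Finset.sum_congr rfl fun i _ => hterm i,
      Finset.sum_range_sub (fun i => ∫ η, c i η ∂M.gibbs), hc0, hc0, sub_zero]
    · intro h
      have := hN _ h
      simp only [he] at this
      omega
    · intro h
      have := hN _ h
      simp only [he] at this
      push_cast at this
      omega
  exact (mul_eq_zero.1 hsum).resolve_left M.T_pos.ne'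

/-- The Liouville operator is antisymmetric for the semi-inner product. -/
lemma semiInner_liouville {f h : Config → ℝ} (hf : IsSmoothLocal f) (hh : IsSmoothLocal h) :
    M.semiInner f (M.liouville h) = -M.semiInner (M.liouville f) h := by
  unfold semiInner
  rw [← finsum_neg_distrib]
  refine finsum_congr fun x => ?_
  have hs := hh.comp_shift x
  -- Invariance applied to f · θ_x h, with the Leibniz rule and commutation with shifts, gives
  -- antisymmetry for each `x`; the products of means vanish by invariance as well.
  have key := (hf.mul hs).integral_liouville (M := M)
  simp only [hf.liouville_mul hs] at key
  have i1 : Integrable (fun η => M.liouville f η * h (shift x η)) M.gibbs :=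
    (memLp_mul_of_bounded hf.liouville_mem.2.2 hs.measurable hs.bounded).integrable (by norm_num)
  have i2 : Integrable (fun η => f η * M.liouville (fun η => h (shift x η)) η) M.gibbs :=
    integrable_mul_of_bounded (hs.liouville_mem.2.2.integrable (by norm_num)) hf.measurable
      hf.bounded
  rw [integral_add i1 i2] at key
  simp only [liouville_shift] at key
  simp only [corr, hf.integral_liouville, hh.integral_liouville]
  linarith

/-! ### The noise is symmetric and negative -/

namespace LocalFun

lemma inner_eq_semiInner (f g : M.LocalFun) : inner ℝ f g = M.semiInner f g := rfl

lemma inner_toHilb (f g : M.LocalFun) : inner ℝ f.toHilb g.toHilb = M.semiInner f g :=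
  UniformSpace.Completion.inner_coe f g

lemma toHilb_add (f g : M.LocalFun) : (f + g).toHilb = f.toHilb + g.toHilb :=
  UniformSpace.Completion.coe_add f g

lemma toHilb_sub (f g : M.LocalFun) : (f - g).toHilb = f.toHilb - g.toHilb :=
  UniformSpace.Completion.coe_sub f g

lemma toHilb_smul (c : ℝ) (f : M.LocalFun) : (c • f).toHilb = c • f.toHilb :=
  UniformSpace.Completion.coe_smul c f

lemma add_apply (f g : M.LocalFun) (η : Config) : (f + g) η = f η + g η := rfl

lemma sub_apply (f g : M.LocalFun) (η : Config) : (f - g) η = f η - g η := rfl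

lemma smul_apply (c : ℝ) (f : M.LocalFun) (η : Config) : (c • f) η = c * f η := rfl

lemma zero_apply (η : Config) : (0 : M.LocalFun) η = 0 := rfl

lemma sum_apply {ι : Type*} (s : Finset ι) (F : ι → M.LocalFun) (η : Config) :
    (∑ i ∈ s, F i) η = ∑ i ∈ s, F i η := by
  classical
  induction s using Finset.induction_on with
  | empty => simp [zero_apply]
  | insert a s ha ih => rw [Finset.sum_insert ha, Finset.sum_insert ha, add_apply, ih]

@[ext]
lemma ext {f g : M.LocalFun} (h : ∀ η, f η = g η) : f = g := Subtype.ext (funext h)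

/-- The translate `θ_x f`. -/
def translate (x : ℤ) (f : M.LocalFun) : M.LocalFun :=
  ⟨fun η => f (shift x η), f.measurable.comp (measurable_shift x),
    by obtain ⟨Λ, h⟩ := f.2.2.1; exact ⟨_, dependsOn_shift h x⟩, f.memLp_shift x⟩

lemma translate_apply (x : ℤ) (f : M.LocalFun) (η : Config) :
    f.translate x η = f (shift x η) := rfl

lemma dependsOn_flip {Λ : Set ℤ} {f : Config → ℝ} (hf : DependsOn f Λ) (y : ℤ) :
    DependsOn (fun η => f (flip y η)) Λ := by
  intro η ζ h
  refine hf fun i hi => ?_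
  rw [flip_apply, flip_apply, h i hi]

/-- The effect `f(η^y) - f(η)` of a velocity flip at `y`. -/
def flipDiff (y : ℤ) (f : M.LocalFun) : M.LocalFun :=
  ⟨fun η => f (flip y η) - f η,
    (f.measurable.comp (M.measurePreserving_flip y).measurable).sub f.measurable,
    by
      obtain ⟨Λ, h⟩ := f.2.2.1
      refine ⟨Λ, fun η ζ he => ?_⟩
      exact congrArg₂ (· - ·) (dependsOn_flip h y he) (h he),
    (f.memLp.comp_measurePreserving (M.measurePreserving_flip y)).sub f.memLp⟩

lemma flipDiff_apply (y : ℤ) (f : M.LocalFun) (η : Config) :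
    f.flipDiff y η = f (flip y η) - f η := rfl

lemma noise_eq_sum {f : M.LocalFun} {Λ S : Finset ℤ} (hf : DependsOn f.fn (Λ : Set ℤ))
    (hS : Λ ⊆ S) (η : Config) : noise f η = (∑ y ∈ S, f.flipDiff y) η := by
  rw [sum_apply]
  refine finsum_eq_sum_of_support_subset _ fun x hx => ?_
  by_contra hn
  exact hx (sub_eq_zero.2 (update_eqOn_of_notMem hf (fun h => hn (hS h)) η _))

lemma integral_flipDiff (y : ℤ) (f : M.LocalFun) : ∫ η, f.flipDiff y η ∂M.gibbs = 0 := by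
  have i : Integrable (fun η => f (flip y η)) M.gibbs :=
    (f.memLp.comp_measurePreserving (M.measurePreserving_flip y)).integrable (by norm_num)
  simp only [flipDiff_apply]
  rw [integral_sub i (f.memLp.integrable (by norm_num)), integral_flip f.measurable, sub_self]

/-- The flip preserves the measure and changes the sign of `g.flipDiff z`; averaging the integral
with its flipped version produces the factor 1/2. -/
lemma integral_mul_flipDiff (z : ℤ) (f g : M.LocalFun) :
    ∫ η, f η * g.flipDiff z η ∂M.gibbs =
      -(1 / 2) * ∫ η, f.flipDiff z η * g.flipDiff z η ∂M.gibbs := by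
  have i1 : Integrable (fun η => f η * g.flipDiff z η) M.gibbs :=
    f.memLp.integrable_mul (g.flipDiff z).memLp
  have h1 := integral_flip (M := M) (f.measurable.mul (g.flipDiff z).measurable) z
  simp only [Pi.mul_apply] at h1
  have h2 : ∀ η, g.flipDiff z (flip z η) = -g.flipDiff z η := fun η => by
    simp only [flipDiff_apply, flip_flip]; ring
  simp only [h2] at h1
  have i2 : Integrable (fun η => f (flip z η) * -g.flipDiff z η) M.gibbs :=
    (f.memLp.comp_measurePreserving (M.measurePreserving_flip z)).integrable_mul
      (g.flipDiff z).memLp.neg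
  have e : ∫ η, f.flipDiff z η * g.flipDiff z η ∂M.gibbs =
      -(∫ η, f (flip z η) * -g.flipDiff z η ∂M.gibbs) - ∫ η, f η * g.flipDiff z η ∂M.gibbs := by
    have i3 : Integrable (fun η => -(f (flip z η) * -g.flipDiff z η)) M.gibbs := i2.neg
    rw [← integral_neg, ← integral_sub i3 i1]
    refine integral_congr_ae (Eventually.of_forall fun η => ?_)
    simp only [flipDiff_apply]
    ring
  rw [e, h1]
  ring

/-- Moving the flipped site to the origin separates the variables: one factor depends on `x + y`
only, the other on `y` only, so the double sum becomes an integral of a product of sums. -/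
lemma corr_flipDiff (f h : M.LocalFun) (x y : ℤ) :
    M.corr f (h.flipDiff y) x = -(1 / 2) * ∫ η, (f.translate (-(x + y))).flipDiff 0 η *
      (h.translate (-y)).flipDiff 0 η ∂M.gibbs := by
  have e1 : ∀ η, h.flipDiff y (shift x η) = (h.translate x).flipDiff (x + y) η := fun η => by
    simp only [flipDiff_apply, translate_apply, shift_flip]
    congr 3
    ring
  rw [corr, integral_flipDiff, mul_zero, sub_zero]
  simp only [e1]
  have hm : Measurable fun η => f.flipDiff (x + y) η * (h.translate x).flipDiff (x + y) η :=
    (f.flipDiff (x + y)).measurable.mul ((h.translate x).flipDiff (x + y)).measurable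
  rw [integral_mul_flipDiff, ← integral_shift _ hm (-(x + y))]
  congr 1
  refine integral_congr_ae (Eventually.of_forall fun η => ?_)
  have e2 : (0 : ℤ) - (-(x + y)) = x + y := by ring
  have e3 : (0 : ℤ) - -y = y := by ring
  have e4 : -(x + y) + x = -y := by ring
  have e5 : x + y - x = y := by ring
  simp only [flipDiff_apply, translate_apply, shift_flip, e2, e3, e5, shift_shift, e4]

lemma translate_flipDiff_eq_zero {f : M.LocalFun} {Λ : Finset ℤ}
    (hf : DependsOn f.fn (Λ : Set ℤ)) {u : ℤ} (hu : u ∉ Λ) (η : Config) :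
    (f.translate (-u)).flipDiff 0 η = 0 := by
  have e : (0 : ℤ) - -u = u := by ring
  simp only [flipDiff_apply, translate_apply, shift_flip, e]
  exact sub_eq_zero.2 (update_eqOn_of_notMem hf (by simpa using hu) _ _)

/-- The Dirichlet form of the noise. -/
lemma semiInner_sum_flipDiff {f : M.LocalFun} {Λ : Finset ℤ} (hf : DependsOn f.fn (Λ : Set ℤ))
    (h : M.LocalFun) :
    M.semiInner f (∑ y ∈ Λ, h.flipDiff y : M.LocalFun).fn = -(1 / 2) *
      ∫ η, (∑ u ∈ Λ, (f.translate (-u)).flipDiff 0 η) *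
        (∑ y ∈ Λ, (h.translate (-y)).flipDiff 0 η) ∂M.gibbs := by
  have h1 : ∀ y, M.semiInner f (h.flipDiff y) = ∑ u ∈ Λ, -(1 / 2) *
      ∫ η, (f.translate (-u)).flipDiff 0 η * (h.translate (-y)).flipDiff 0 η ∂M.gibbs := by
    intro y
    unfold semiInner
    simp only [corr_flipDiff]
    -- With u = x + y in place of x, the `f` factor no longer involves y.
    refine (finsum_comp_equiv (Equiv.addRight y) (f := fun u => -(1 / 2) *
      ∫ η, (f.translate (-u)).flipDiff 0 η * (h.translate (-y)).flipDiff 0 η ∂M.gibbs)).trans ?_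
    refine finsum_eq_sum_of_support_subset _ fun u hu => ?_
    by_contra hn
    refine hu ?_
    simp only [translate_flipDiff_eq_zero hf hn, zero_mul, integral_zero, mul_zero]
  rw [← inner_eq_semiInner, inner_sum]
  simp only [inner_eq_semiInner, h1]
  have hi : ∀ u y : ℤ, Integrable (fun η => (f.translate (-u)).flipDiff 0 η *
      (h.translate (-y)).flipDiff 0 η) M.gibbs := fun u y =>
    ((f.translate (-u)).flipDiff 0).memLp.integrable_mul ((h.translate (-y)).flipDiff 0).memLp
  simp only [Finset.sum_mul_sum]
  rw [integral_finsetSum _ fun u _ => integrable_finsetSum _ fun y _ => hi u y, Finset.mul_sum,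
    Finset.sum_comm]
  refine Finset.sum_congr rfl fun u _ => ?_
  rw [integral_finsetSum _ fun y _ => hi u y, Finset.mul_sum]

lemma exists_noise (f : M.LocalFun) : ∃ s : M.LocalFun, ∀ η, s η = noise f η := by
  obtain ⟨Λ, h⟩ := f.2.2.1
  exact ⟨_, fun η => (noise_eq_sum h le_rfl η).symm⟩

/-- For `h = f` the Dirichlet form is minus one half of the integral of a square. -/
lemma semiInner_noise_self_nonpos (f : M.LocalFun) : M.semiInner f (noise f) ≤ 0 := by
  obtain ⟨Λ, h⟩ := f.2.2.1
  have e : noise f = (∑ y ∈ Λ, f.flipDiff y : M.LocalFun).fn :=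
    funext fun η => noise_eq_sum h le_rfl η
  rw [e, semiInner_sum_flipDiff h]
  have : 0 ≤ ∫ η, (∑ u ∈ Λ, (f.translate (-u)).flipDiff 0 η) *
        (∑ y ∈ Λ, (f.translate (-y)).flipDiff 0 η) ∂M.gibbs :=
    integral_nonneg fun η => mul_self_nonneg _
  linarith

lemma semiInner_comm (f g : M.LocalFun) : M.semiInner f g = M.semiInner g f :=
  (real_inner_comm f g).symm

/-- The Dirichlet form is visibly symmetric once both functions are summed over a common finite set.
-/
lemma semiInner_noise_comm (f h : M.LocalFun) :
    M.semiInner f (noise h) = M.semiInner (noise f) h := by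
  obtain ⟨Λ₁, h1⟩ := f.2.2.1
  obtain ⟨Λ₂, h2⟩ := h.2.2.1
  have h1' : DependsOn f.fn ((Λ₁ ∪ Λ₂ : Finset ℤ) : Set ℤ) := h1.mono (by simp)
  have h2' : DependsOn h.fn ((Λ₁ ∪ Λ₂ : Finset ℤ) : Set ℤ) := h2.mono (by simp)
  have e1 : noise f = (∑ y ∈ Λ₁ ∪ Λ₂, f.flipDiff y : M.LocalFun).fn :=
    funext fun η => noise_eq_sum h1' le_rfl η
  have e2 : noise h = (∑ y ∈ Λ₁ ∪ Λ₂, h.flipDiff y : M.LocalFun).fn :=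
    funext fun η => noise_eq_sum h2' le_rfl η
  rw [e1, e2, semiInner_comm _ h, semiInner_sum_flipDiff h1', semiInner_sum_flipDiff h2']
  simp only [mul_comm]

end LocalFun

lemma IsSmoothLocal.exists_liouville {f : Config → ℝ} (hf : IsSmoothLocal f) :
    ∃ a : M.LocalFun, a.fn = M.liouville f := ⟨⟨_, hf.liouville_mem⟩, rfl⟩

lemma isSmoothLocal_zero : IsSmoothLocal fun _ => 0 where
  measurable := measurable_const
  dependsOn := ⟨∅, fun _ _ _ => rfl⟩
  bounded := ⟨0, by simp⟩
  differentiableR := by simp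
  differentiableP := by simp
  measurable_partialR x := by
    have : partialR x (fun _ => 0) = fun _ => 0 := by funext η; simp [partialR]
    rw [this]; exact measurable_const
  measurable_partialP x := by
    have : partialP x (fun _ => 0) = fun _ => 0 := by funext η; simp [partialP]
    rw [this]; exact measurable_const
  bounded_partialR x := ⟨0, by simp [partialR]⟩
  bounded_partialP x := ⟨0, by simp [partialP]⟩

/-! ### Dissipativity -/

/-- The pairs of a bounded differentiable local function and its image by the generator form a
linear space. -/
lemma exists_of_mem_span {q : M.Hilb × M.Hilb}
    (hq : q ∈ Submodule.span ℝ {q : M.Hilb × M.Hilb | ∃ f g : M.LocalFun, IsLocalTest f ∧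
      (∀ η, g η = M.formalGenerator f η) ∧ q = (f.toHilb, g.toHilb)}) :
    ∃ f a s : M.LocalFun, IsSmoothLocal f.fn ∧ a.fn = M.liouville f ∧ s.fn = noise f ∧
      q = (f.toHilb, (a + M.γ • s).toHilb) := by
  have hadd : ∀ f g : M.LocalFun, ∀ η, noise (f + g : M.LocalFun) η = noise f η + noise g η := by
    intro f g η
    obtain ⟨Λ₁, h1⟩ := f.2.2.1
    obtain ⟨Λ₂, h2⟩ := g.2.2.1
    have h1' : DependsOn f.fn ((Λ₁ ∪ Λ₂ : Finset ℤ) : Set ℤ) := h1.mono (by simp)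
    have h2' : DependsOn g.fn ((Λ₁ ∪ Λ₂ : Finset ℤ) : Set ℤ) := h2.mono (by simp)
    have h3 : DependsOn (f + g).fn ((Λ₁ ∪ Λ₂ : Finset ℤ) : Set ℤ) := fun η ζ h => by
      rw [LocalFun.add_apply, LocalFun.add_apply, h1' h, h2' h]
    rw [LocalFun.noise_eq_sum h1' le_rfl, LocalFun.noise_eq_sum h2' le_rfl,
      LocalFun.noise_eq_sum h3 le_rfl]
    simp only [LocalFun.sum_apply, ← Finset.sum_add_distrib]
    refine Finset.sum_congr rfl fun y _ => ?_
    simp only [LocalFun.flipDiff_apply, LocalFun.add_apply]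
    ring
  induction hq using Submodule.span_induction with
  | mem q hq =>
    obtain ⟨f, g, hf, hg, rfl⟩ := hq
    obtain ⟨s, hs⟩ := f.exists_noise
    obtain ⟨a, ha⟩ := hf.isSmoothLocal.exists_liouville (M := M)
    refine ⟨f, a, s, hf.isSmoothLocal, ha, funext hs, ?_⟩
    congr 2
    ext η
    rw [hg, LocalFun.add_apply, LocalFun.smul_apply, hs, ha]
    rfl
  | zero =>
    have hz : (0 : M.LocalFun).fn = (fun _ => 0) := rfl
    refine ⟨0, 0, 0, isSmoothLocal_zero, ?_, ?_, ?_⟩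
    · rw [hz]; funext η; simp [liouville, partialR, partialP]
    · rw [hz]; funext η; simp [noise]
    · have h0 : (0 : M.LocalFun).toHilb = 0 := UniformSpace.Completion.coe_zero
      rw [smul_zero, add_zero, h0]
      rfl
  | add q q' _ _ h h' =>
    obtain ⟨f, a, s, hf, ha, hs, rfl⟩ := h
    obtain ⟨f', a', s', hf', ha', hs', rfl⟩ := h'
    refine ⟨f + f', a + a', s + s', hf.add hf', ?_, ?_, ?_⟩
    · funext η
      rw [LocalFun.add_apply, ha, ha']
      exact (hf.liouville_add hf' η).symm
    · funext η
      rw [LocalFun.add_apply, hs, hs', hadd]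
    · simp only [LocalFun.toHilb_add, LocalFun.toHilb_smul, Prod.mk_add_mk, smul_add]
      congr 1
      abel
  | smul c q _ h =>
    obtain ⟨f, a, s, hf, ha, hs, rfl⟩ := h
    refine ⟨c • f, c • a, c • s, hf.smul c, ?_, ?_, ?_⟩
    · funext η
      rw [LocalFun.smul_apply, ha]
      exact (hf.liouville_smul c η).symm
    · funext η
      rw [LocalFun.smul_apply, hs, noise, noise, mul_finsum]
      refine finsum_congr fun y => ?_
      simp only [LocalFun.smul_apply]
      ring
    · simp only [LocalFun.toHilb_add, LocalFun.toHilb_smul, Prod.smul_mk, smul_add, smul_smul,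
        mul_comm]

variable (M) in
-- The inequality is a closed condition, so it suffices to check it on the span; there the
-- antisymmetric part drops out and the noise is nonpositive.
lemma generatorGraph_dissipative (q : M.Hilb × M.Hilb) (hq : q ∈ M.generatorGraph) :
    inner ℝ q.1 q.2 ≤ 0 := by
  have hcl : IsClosed {q : M.Hilb × M.Hilb | inner ℝ q.1 q.2 ≤ 0} :=
    isClosed_le (by fun_prop) continuous_const
  refine closure_minimal (fun q hq => ?_) hcl hq
  obtain ⟨f, a, s, hf, ha, hs, rfl⟩ := exists_of_mem_span hq
  have h1 : M.semiInner f a = 0 := by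
    have := semiInner_liouville (M := M) hf hf
    rw [← ha, LocalFun.semiInner_comm a f] at this
    linarith
  have h2 : M.semiInner f s ≤ 0 := by rw [hs]; exact f.semiInner_noise_self_nonpos
  simp only [Set.mem_ofPred_eq, LocalFun.toHilb_add, LocalFun.toHilb_smul, inner_add_right,
    inner_smul_right, LocalFun.inner_toHilb, h1, zero_add]
  exact mul_nonpos_of_nonneg_of_nonpos M.γ_pos.le h2

theorem existsUnique_solvesResolvent (hL : M.GeneratesSemigroup) {l : ℝ} (hl : 0 < l)
    (g : M.Hilb) : ∃! u : M.Hilb, M.SolvesResolvent l g u := by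
  obtain ⟨P, h0, hadd, hcont, hgen⟩ := hL
  exact existsUnique_resolvent_of_dissipative M.generatorGraph M.generatorGraph_dissipative P h0
    hadd hcont hgen hl g

/-! ### Translation invariance and convergence in the Hilbert space -/

namespace LocalFun

lemma corr_translate_left (f g : M.LocalFun) (x y : ℤ) :
    M.corr (f.translate x) g y = M.corr f g (y - x) := by
  have hm : Measurable fun η => f η * g (shift (y - x) η) :=
    f.measurable.mul (g.measurable.comp (measurable_shift _))
  have h := integral_shift (M := M) _ hm x
  simp only [shift_shift, add_sub_cancel] at h
  simp only [corr, translate_apply, integral_shift _ f.measurable, h]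

/-- Summation over all shifts gives a function and its translate the same pairing with every local
function, so their difference has zero norm. This is what kills V'(r_1) - V'(r_0). -/
lemma toHilb_translate (f : M.LocalFun) (x : ℤ) : (f.translate x).toHilb = f.toHilb := by
  have key : ∀ g : M.LocalFun, M.semiInner (f.translate x) g = M.semiInner f g := by
    intro g
    unfold semiInner
    simp only [corr_translate_left]
    exact finsum_comp_equiv (Equiv.subRight x) (f := fun y => M.corr f g y)
  rw [← sub_eq_zero, ← inner_self_eq_zero (𝕜 := ℝ), ← toHilb_sub]
  nth_rewrite 1 [toHilb_sub]
  rw [inner_sub_left, inner_toHilb, inner_toHilb, key, sub_self]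

/-- For functions of the coordinates at given sites, the norm of the Hilbert space is controlled by
the `L²` norm. -/
lemma semiInner_self_le {f : M.LocalFun} {Λ : Finset ℤ} (hf : DependsOn f.fn (Λ : Set ℤ)) :
    M.semiInner f f ≤
      ((Λ ×ˢ Λ).image fun q => q.1 - q.2).card * ∫ η, f η ^ 2 ∂M.gibbs := by
  set S := (Λ ×ˢ Λ).image fun q => q.1 - q.2 with hS
  -- Independence leaves only the shifts in Λ - Λ, and each correlation is at most μ(f²) by 2ab ≤ a²
  -- + b² and shift invariance.
  have hsupp : Function.support (M.corr f f) ⊆ S := by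
    intro x hx
    by_contra hn
    refine hx ?_
    have hdisj : Disjoint Λ (Λ.image fun z => x + z) := by
      rw [Finset.disjoint_left]
      intro i hi hi'
      obtain ⟨z, hz, rfl⟩ := Finset.mem_image.1 hi'
      refine hn (Finset.mem_coe.2 (Finset.mem_image.2 ⟨(x + z, z), ?_, by simp⟩))
      exact Finset.mem_product.2 ⟨hi, hz⟩
    have hm : Measurable fun η => f (shift x η) := f.measurable.comp (measurable_shift x)
    rw [corr, integral_mul_of_disjoint (M := M) f.measurable hm hf (dependsOn_shift hf x) hdisj,
      integral_shift _ f.measurable, sub_self]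
  have hle : ∀ x, M.corr f f x ≤ ∫ η, f η ^ 2 ∂M.gibbs := by
    intro x
    have i1 : Integrable (fun η => f η ^ 2) M.gibbs := f.memLp.integrable_sq
    have i2 : Integrable (fun η => f (shift x η) ^ 2) M.gibbs := (f.memLp_shift x).integrable_sq
    have h1 : ∫ η, f η * f (shift x η) ∂M.gibbs ≤
        ∫ η, (1 / 2) * (f η ^ 2 + f (shift x η) ^ 2) ∂M.gibbs :=
      integral_mono (f.integrable_mul_shift' f x) ((i1.add i2).const_mul _) fun η => by
        simp only
        nlinarith [sq_nonneg (f η - f (shift x η))]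
    rw [integral_const_mul, integral_add i1 i2,
      integral_shift (fun η => f η ^ 2) (f.measurable.pow_const 2)] at h1
    rw [corr]
    nlinarith [mul_self_nonneg (∫ η, f η ∂M.gibbs)]
  have : M.semiInner f f = ∑ x ∈ S, M.corr f f x := finsum_eq_sum_of_support_subset _ hsupp
  rw [this]
  simpa using Finset.sum_le_card_nsmul S _ _ fun x _ => hle x

/-- A single `Λ` for the whole sequence is essential: the constant comparing the two norms depends
on it. -/
lemma tendsto_toHilb {F : ℕ → M.LocalFun} {f : M.LocalFun} {Λ : Finset ℤ}
    (hF : ∀ n, DependsOn (F n).fn (Λ : Set ℤ)) (hf : DependsOn f.fn (Λ : Set ℤ))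
    (h : Tendsto (fun n => ∫ η, (F n η - f η) ^ 2 ∂M.gibbs) atTop (𝓝 0)) :
    Tendsto (fun n => (F n).toHilb) atTop (𝓝 f.toHilb) := by
  rw [tendsto_iff_norm_sub_tendsto_zero]
  have hsq : Tendsto (fun n => ‖(F n).toHilb - f.toHilb‖ ^ 2) atTop (𝓝 0) := by
    have h' := h.const_mul (((Λ ×ˢ Λ).image fun q => q.1 - q.2).card : ℝ)
    rw [mul_zero] at h'
    refine squeeze_zero (fun n => sq_nonneg _) (fun n => ?_) h'
    rw [← toHilb_sub, ← real_inner_self_eq_norm_sq, inner_toHilb]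
    refine semiInner_self_le fun η ζ he => ?_
    rw [sub_apply, sub_apply, hF n he, hf he]
  simpa using hsq.sqrt

end LocalFun

/-- Dominated convergence in the form of the truncation errors: fixed square integrable factors
times bounded multipliers vanishing pointwise. The two terms match the r and p derivatives. -/
lemma tendsto_integral_sq_zero {u w : Config → ℝ} (hu : MemLp u 2 M.gibbs)
    (hw : MemLp w 2 M.gibbs) {m k : ℕ → Config → ℝ} (hm : ∀ n, Measurable (m n))
    (hk : ∀ n, Measurable (k n)) {C : ℝ} (hmC : ∀ n η, |m n η| ≤ C) (hkC : ∀ n η, |k n η| ≤ C)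
    (hm0 : ∀ η, Tendsto (fun n => m n η) atTop (𝓝 0))
    (hk0 : ∀ η, Tendsto (fun n => k n η) atTop (𝓝 0)) :
    Tendsto (fun n => ∫ η, (u η * m n η + w η * k n η) ^ 2 ∂M.gibbs) atTop (𝓝 0) := by
  have key := tendsto_integral_of_dominated_convergence (μ := M.gibbs)
    (F := fun n η => (u η * m n η + w η * k n η) ^ 2) (f := fun _ => 0)
    (fun η => 2 * C ^ 2 * (u η ^ 2 + w η ^ 2))
    (fun n => ((hu.1.mul (hm n).aestronglyMeasurable).add
      (hw.1.mul (hk n).aestronglyMeasurable)).pow 2)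
    ((hu.integrable_sq.add hw.integrable_sq).const_mul _)
    (fun n => Eventually.of_forall fun η => ?_) (Eventually.of_forall fun η => ?_)
  · simpa using key
  · have h1 : m n η ^ 2 ≤ C ^ 2 := sq_le_sq' (by linarith [neg_abs_le (m n η), hmC n η])
      (le_trans (le_abs_self _) (hmC n η))
    have h2 : k n η ^ 2 ≤ C ^ 2 := sq_le_sq' (by linarith [neg_abs_le (k n η), hkC n η])
      (le_trans (le_abs_self _) (hkC n η))
    rw [Real.norm_of_nonneg (sq_nonneg _)]
    nlinarith [sq_nonneg (u η * m n η - w η * k n η),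
      mul_le_mul_of_nonneg_left h1 (sq_nonneg (u η)),
      mul_le_mul_of_nonneg_left h2 (sq_nonneg (w η))]
  · simpa using (((hm0 η).const_mul (u η)).add ((hk0 η).const_mul (w η))).pow 2

variable (M) in
lemma memLp_p_mul_p (x y : ℤ) : MemLp (fun η : Config => (η x).2 * (η y).2) 2 M.gibbs :=
  MemLp.mul (p := 4) (q := 4) (r := 2) (M.memLp_p y 4 (by norm_num)) (M.memLp_p x 4 (by norm_num))
    (hpqr := ⟨by
      rw [show (4 : ℝ≥0∞) = 2 * 2 by norm_num, ENNReal.mul_inv (by simp) (by simp), ← mul_add,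
        ENNReal.inv_two_add_inv_two, mul_one]⟩)

/-! ### The momentum as an eigenvector of the generator -/

/-- A smooth even cutoff function on the line. -/
def cutoff : ContDiffBump (0 : ℝ) := ⟨1, 2, one_pos, one_lt_two⟩

lemma hasDerivAt_cutoff (s : ℝ) : HasDerivAt cutoff (deriv cutoff s) s :=
  ((cutoff.contDiff (n := 1)).differentiable (by norm_num) s).hasDerivAt

lemma continuous_deriv_cutoff : Continuous (deriv cutoff) :=
  (cutoff.contDiff (n := 1)).continuous_deriv (by norm_num)

lemma cutoff_zero : cutoff 0 = 1 := cutoff.one_of_mem_closedBall (by simp [cutoff])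

lemma abs_cutoff_le (s : ℝ) : |cutoff s| ≤ 1 := by
  rw [abs_of_nonneg cutoff.nonneg]; exact cutoff.le_one

/-- The momentum at the origin, cut off at distance of order `1 / c`. -/
def cutoffMomentum (c : ℝ) (η : Config) : ℝ :=
  (η 0).2 * cutoff (c * (η 0).2) * cutoff (c * (η 0).1)

lemma isLocalTest_cutoffMomentum {c : ℝ} (hc : 0 < c) : IsLocalTest (cutoffMomentum c) := by
  refine ⟨{0}, fun y => (y ⟨0, by simp⟩).2 * cutoff (c * (y ⟨0, by simp⟩).2) *
    cutoff (c * (y ⟨0, by simp⟩).1), ?_, ?_, fun η => rfl⟩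
  · have h := cutoff.contDiff (n := 1)
    have h1 : ContDiff ℝ 1 fun y : (({0} : Finset ℤ) → ℝ × ℝ) => (y ⟨0, by simp⟩).1 := by fun_prop
    have h2 : ContDiff ℝ 1 fun y : (({0} : Finset ℤ) → ℝ × ℝ) => (y ⟨0, by simp⟩).2 := by fun_prop
    exact (h2.mul (h.comp (contDiff_const.mul h2))).mul (h.comp (contDiff_const.mul h1))
  · refine HasCompactSupport.of_support_subset_isCompact
      (isCompact_closedBall (0 : ({0} : Finset ℤ) → ℝ × ℝ) (2 / c)) fun y hy => ?_
    have hz : ∀ s : ℝ, cutoff (c * s) ≠ 0 → |s| ≤ 2 / c := by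
      intro s hs
      by_contra! hlt
      refine hs (cutoff.zero_of_le_dist ?_)
      rw [div_lt_iff₀ hc] at hlt
      simp only [cutoff, dist_zero_right, norm_mul, Real.norm_eq_abs, abs_of_pos hc]
      linarith
    have hy' := mul_ne_zero_iff.1 hy
    have hy2 := hz _ (mul_ne_zero_iff.1 hy'.1).2
    have hy1 := hz _ hy'.2
    rw [mem_closedBall_zero_iff, pi_norm_le_iff_of_nonneg (by positivity)]
    rintro ⟨i, hi⟩
    have hi0 : i = 0 := by simpa using hi
    subst hi0
    exact max_le hy1 hy2

lemma dependsOn_cutoffMomentum (c : ℝ) :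
    DependsOn (cutoffMomentum c) (({0} : Finset ℤ) : Set ℤ) := fun η ζ h => by
  simp only [cutoffMomentum, h 0 (by simp)]

lemma partialR_cutoffMomentum (c : ℝ) (η : Config) :
    partialR 0 (cutoffMomentum c) η =
      (η 0).2 * (cutoff (c * (η 0).2) * (c * deriv cutoff (c * (η 0).1))) := by
  simp only [partialR, cutoffMomentum, Function.update_self]
  have h : HasDerivAt (fun s : ℝ => cutoff (c * s)) (deriv cutoff (c * (η 0).1) * (c * 1))
      (η 0).1 := (hasDerivAt_cutoff _).comp _ ((hasDerivAt_id _).const_mul c)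
  rw [(h.const_mul _).deriv]
  ring

lemma partialP_cutoffMomentum (c : ℝ) (η : Config) :
    partialP 0 (cutoffMomentum c) η =
      (cutoff (c * (η 0).2) + c * (η 0).2 * deriv cutoff (c * (η 0).2)) *
        cutoff (c * (η 0).1) := by
  simp only [partialP, cutoffMomentum, Function.update_self]
  have h : HasDerivAt (fun s : ℝ => cutoff (c * s)) (deriv cutoff (c * (η 0).2) * (c * 1))
      (η 0).2 := (hasDerivAt_cutoff _).comp _ ((hasDerivAt_id _).const_mul c)
  refine (((hasDerivAt_id' (η 0).2).fun_mul h).mul_const _).deriv.trans ?_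
  ring

lemma liouville_cutoffMomentum (c : ℝ) (η : Config) :
    M.liouville (cutoffMomentum c) η =
      ((η 0).2 - (η (-1)).2) * ((η 0).2 *
        (cutoff (c * (η 0).2) * (c * deriv cutoff (c * (η 0).1)))) +
      (deriv M.V (η 1).1 - deriv M.V (η 0).1) *
        ((cutoff (c * (η 0).2) + c * (η 0).2 * deriv cutoff (c * (η 0).2)) *
          cutoff (c * (η 0).1)) := by
  rw [liouville_eq_sum (dependsOn_cutoffMomentum c) le_rfl, Finset.sum_singleton,
    partialR_cutoffMomentum, partialP_cutoffMomentum, zero_sub, zero_add]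

/-- The bound on s χ'(s), χ being the cutoff, controls c p χ'(c p), which arises from
differentiating the truncated momentum in p, uniformly in the scale c. -/
lemma exists_bound_cutoff : ∃ C : ℝ, 1 ≤ C ∧ (∀ s, |deriv cutoff s| ≤ C) ∧
    ∀ s, |s * deriv cutoff s| ≤ C := by
  have hs : HasCompactSupport (deriv cutoff) := cutoff.hasCompactSupport.deriv
  obtain ⟨A, hA⟩ := continuous_deriv_cutoff.bounded_above_of_compact_support hs
  obtain ⟨B, hB⟩ := (continuous_id.mul continuous_deriv_cutoff).bounded_above_of_compact_support
    hs.mul_left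
  refine ⟨max 1 (max A B), le_max_left _ _, fun s => ?_, fun s => ?_⟩
  · exact (hA s).trans ((le_max_left _ _).trans (le_max_right _ _))
  · exact (hB s).trans ((le_max_right _ _).trans (le_max_right _ _))

variable (M) in
/-- The force `V'(r_x)`. -/
def force (x : ℤ) : M.LocalFun :=
  ⟨fun η => deriv M.V (η x).1, measurable_deriv_V x,
    ⟨{x}, fun η ζ h => by simp only [h x (by simp)]⟩, M.memLp_deriv_V_two x⟩

variable (M) in
lemma toHilb_force_sub : (M.force 1 - M.force 0).toHilb = 0 := by
  have h : M.force 1 = (M.force 0).translate 1 := by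
    ext η
    rfl
  rw [LocalFun.toHilb_sub, h, LocalFun.toHilb_translate, sub_self]

variable (M) in
/-- The momentum `p_0` is approximated in graph norm by compactly supported local functions. -/
lemma exists_approx_p0 : ∃ F A : ℕ → M.LocalFun, (∀ n, IsLocalTest (F n)) ∧
    (∀ n, (A n).fn = M.liouville (F n)) ∧ (∀ n, noise (F n) = ((-2 : ℝ) • F n).fn) ∧
    Tendsto (fun n => (F n).toHilb) atTop (𝓝 M.p0.toHilb) ∧
    Tendsto (fun n => (A n).toHilb) atTop (𝓝 0) := by
  set c : ℕ → ℝ := fun n => 1 / ((n : ℝ) + 1) with hc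
  have hcpos : ∀ n, 0 < c n := fun n => by positivity
  have hc1 : ∀ n, c n ≤ 1 := fun n => by
    rw [hc]; simp only
    rw [div_le_one (by positivity)]
    linarith [n.cast_nonneg (α := ℝ)]
  have hc0 : Tendsto c atTop (𝓝 0) := tendsto_one_div_add_atTop_nhds_zero_nat
  have hcs : ∀ s : ℝ, Tendsto (fun n => c n * s) atTop (𝓝 0) := fun s => by
    simpa using hc0.mul_const s
  have hχ : ∀ s : ℝ, Tendsto (fun n => cutoff (c n * s)) atTop (𝓝 1) := fun s => by
    have := (cutoff.continuous.tendsto 0).comp (hcs s)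
    rwa [cutoff_zero] at this
  have hχ' : ∀ s : ℝ, Tendsto (fun n => deriv cutoff (c n * s)) atTop (𝓝 (deriv cutoff 0)) :=
    fun s => (continuous_deriv_cutoff.tendsto 0).comp (hcs s)
  obtain ⟨C, hC1, hC, hC'⟩ := exists_bound_cutoff
  have hmχ : Measurable cutoff := cutoff.continuous.measurable
  have hmχ' : Measurable (deriv cutoff) := continuous_deriv_cutoff.measurable
  have hsm := fun n => (isLocalTest_cutoffMomentum (hcpos n)).isSmoothLocal
  let F : ℕ → M.LocalFun := fun n =>
    ⟨cutoffMomentum (c n), (hsm n).measurable, (hsm n).dependsOn, (hsm n).memLp 2⟩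
  have hFfn : ∀ n, (F n).fn = cutoffMomentum (c n) := fun n => rfl
  choose A hA using fun n => (hsm n).exists_liouville (M := M)
  refine ⟨F, A, fun n => isLocalTest_cutoffMomentum (hcpos n), hA, fun n => ?_, ?_, ?_⟩
  · funext η
    rw [LocalFun.noise_eq_sum (f := F n) (Λ := {0}) (dependsOn_cutoffMomentum (c n)) le_rfl,
      Finset.sum_singleton, LocalFun.flipDiff_apply, LocalFun.smul_apply, hFfn]
    -- The cutoff is even, so the truncated momentum stays odd in p_0 and is an exact eigenfunction
    -- of the noise.
    simp only [cutoffMomentum, flip_apply, if_true, mul_neg, ContDiffBump.neg]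
    ring
  · refine LocalFun.tendsto_toHilb (Λ := {0}) (fun n => dependsOn_cutoffMomentum (c n))
      (fun η ζ h => ?_) ?_
    · change (η 0).2 = (ζ 0).2
      rw [h 0 (by simp)]
    · have := tendsto_integral_sq_zero (M.memLp_p 0 2 (by norm_num)) (MemLp.zero (μ := M.gibbs))
        (m := fun n η => cutoff (c n * (η 0).2) * cutoff (c n * (η 0).1) - 1)
        (k := fun n η => 0) (C := 2) (fun n => by fun_prop) (fun n => measurable_const)
        (fun n η => ?_) (fun n η => by simp) (fun η => ?_) (fun η => tendsto_const_nhds)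
      · refine this.congr fun n => integral_congr_ae (Eventually.of_forall fun η => ?_)
        change _ = (cutoffMomentum (c n) η - (η 0).2) ^ 2
        simp only [cutoffMomentum]
        ring
      · have h1 := abs_sub (cutoff (c n * (η 0).2) * cutoff (c n * (η 0).1)) 1
        rw [abs_mul, abs_one] at h1
        have h2 := mul_le_one₀ (abs_cutoff_le (c n * (η 0).2)) (abs_nonneg _)
          (abs_cutoff_le (c n * (η 0).1))
        linarith
      · simpa using ((hχ (η 0).2).mul (hχ (η 0).1)).sub_const 1
  -- The images converge in L² to V'(r_1) - V'(r_0), a nonzero function in general, but one whose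
  -- class in the Hilbert space is 0.
  · rw [← M.toHilb_force_sub]
    refine LocalFun.tendsto_toHilb (Λ := {-1, 0, 1}) (fun n η ζ h => ?_) (fun η ζ h => ?_) ?_
    · rw [hA]
      simp only [liouville_cutoffMomentum, h 0 (by simp), h 1 (by simp), h (-1) (by simp)]
    · change deriv M.V (η 1).1 - deriv M.V (η 0).1 = deriv M.V (ζ 1).1 - deriv M.V (ζ 0).1
      rw [h 0 (by simp), h 1 (by simp)]
    · have := tendsto_integral_sq_zero
        ((M.memLp_p_mul_p 0 0).sub (M.memLp_p_mul_p (-1) 0)) (M.memLp_deriv_V_sub 1 0)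
        -- `m` comes from ∂_r of the cutoff, with coefficient (p_0 - p_{-1}) p_0; `k` is the error
        -- in ∂_p of the truncated momentum, whose limit is 1.
        (m := fun n η => cutoff (c n * (η 0).2) * (c n * deriv cutoff (c n * (η 0).1)))
        (k := fun n η => (cutoff (c n * (η 0).2) + c n * (η 0).2 * deriv cutoff (c n * (η 0).2)) *
          cutoff (c n * (η 0).1) - 1) (C := C + 2) (fun n => by fun_prop) (fun n => by fun_prop)
        (fun n η => ?_) (fun n η => ?_) (fun η => ?_) (fun η => ?_)
      · refine this.congr fun n => integral_congr_ae (Eventually.of_forall fun η => ?_)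
        have e : (M.force 1 - M.force 0) η = deriv M.V (η 1).1 - deriv M.V (η 0).1 := rfl
        simp only [hA, e, liouville_cutoffMomentum, Pi.sub_apply]
        ring
      · rw [abs_mul, abs_mul, abs_of_pos (hcpos n)]
        have h1 := mul_le_mul (hc1 n) (hC (c n * (η 0).1)) (abs_nonneg _) zero_le_one
        have h2 := mul_le_mul (abs_cutoff_le (c n * (η 0).2)) h1
          (mul_nonneg (hcpos n).le (abs_nonneg _)) zero_le_one
        linarith
      · have h1 := abs_sub ((cutoff (c n * (η 0).2) +
          c n * (η 0).2 * deriv cutoff (c n * (η 0).2)) * cutoff (c n * (η 0).1)) 1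
        rw [abs_mul, abs_one] at h1
        have h2 := abs_add_le (cutoff (c n * (η 0).2))
          (c n * (η 0).2 * deriv cutoff (c n * (η 0).2))
        have h3 := hC' (c n * (η 0).2)
        have h4 := abs_cutoff_le (c n * (η 0).2)
        have h5 := mul_le_mul (h2.trans (add_le_add h4 h3)) (abs_cutoff_le (c n * (η 0).1))
          (abs_nonneg _) (by linarith)
        linarith
      · simpa using (hχ (η 0).2).mul (hc0.mul (hχ' (η 0).1))
      · simpa using (((hχ (η 0).2).add ((hcs (η 0).2).mul (hχ' (η 0).2))).mul
          (hχ (η 0).1)).sub_const 1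

variable (M) in
lemma p0_mem_generatorGraph :
    (M.p0.toHilb, (-2 * M.γ) • M.p0.toHilb) ∈ M.generatorGraph := by
  obtain ⟨F, A, hF, hA, hN, hF0, hA0⟩ := M.exists_approx_p0
  have hlim : Tendsto (fun n => ((F n).toHilb, (A n + M.γ • ((-2 : ℝ) • F n)).toHilb)) atTop
      (𝓝 (M.p0.toHilb, (-2 * M.γ) • M.p0.toHilb)) := by
    refine hF0.prodMk_nhds ?_
    have := hA0.add (hF0.const_smul (-2 * M.γ))
    rw [zero_add] at this
    refine this.congr fun n => ?_
    rw [LocalFun.toHilb_add, LocalFun.toHilb_smul, LocalFun.toHilb_smul, smul_smul, mul_comm]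
  refine (Submodule.isClosed_topologicalClosure _).mem_of_tendsto hlim
    (Eventually.of_forall fun n => ?_)
  refine Submodule.le_topologicalClosure _ (Submodule.subset_span ⟨F n, _, hF n, fun η => ?_, rfl⟩)
  rw [LocalFun.add_apply, hA, LocalFun.smul_apply, ← hN, formalGenerator]

/-- The momentum `p_0` is an eigenvector of the adjoint of the generator. -/
lemma inner_p0_of_mem_generatorGraph {q : M.Hilb × M.Hilb} (hq : q ∈ M.generatorGraph) :
    inner ℝ M.p0.toHilb q.2 = (-2 * M.γ) * inner ℝ M.p0.toHilb q.1 := by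
  obtain ⟨F, A, hF, hA, hN, hF0, hA0⟩ := M.exists_approx_p0
  have hcl : IsClosed {q : M.Hilb × M.Hilb |
      inner ℝ M.p0.toHilb q.2 = (-2 * M.γ) * inner ℝ M.p0.toHilb q.1} :=
    isClosed_eq (by fun_prop) (by fun_prop)
  refine closure_minimal (fun q hq => ?_) hcl hq
  obtain ⟨f, a, s, hf, ha, hs, rfl⟩ := exists_of_mem_span hq
  -- Antisymmetry is available only for bounded functions, so it is applied to the truncations `F
  -- n`, whose Liouville images tend to 0.
  have h1 : inner ℝ M.p0.toHilb a.toHilb = 0 := by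
    refine tendsto_nhds_unique (hF0.inner tendsto_const_nhds) ?_
    have := (hA0.inner (𝕜 := ℝ) (tendsto_const_nhds (x := f.toHilb))).neg
    rw [inner_zero_left, neg_zero] at this
    refine this.congr fun n => ?_
    rw [LocalFun.inner_toHilb, LocalFun.inner_toHilb, ha, hA,
      semiInner_liouville (hF n).isSmoothLocal hf]
  -- The noise is symmetric and multiplies each `F n` by -2.
  have h2 : inner ℝ M.p0.toHilb s.toHilb = -2 * inner ℝ M.p0.toHilb f.toHilb := by
    refine tendsto_nhds_unique (hF0.inner tendsto_const_nhds) ?_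
    refine ((hF0.inner (tendsto_const_nhds (x := f.toHilb))).const_mul (-2)).congr fun n => ?_
    rw [LocalFun.inner_toHilb (F n) s, hs, LocalFun.semiInner_noise_comm, hN,
      ← LocalFun.inner_toHilb, LocalFun.toHilb_smul, inner_smul_left]
    simp
  simp only [Set.mem_ofPred_eq, LocalFun.toHilb_add, LocalFun.toHilb_smul, inner_add_right,
    inner_smul_right, h1, h2]
  ring

/-! ### The currents are orthogonal -/

variable (M) in
-- For shifts x ≠ 0 the integrand is odd in p_0. For x = 0 it is -p_0²(V'(r_1) - τ), whose mean
-- vanishes because τ is the mean of V'(r_1).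
lemma inner_current_p0 : inner ℝ (M.j01 + M.τ • M.p0).toHilb M.p0.toHilb = 0 := by
  have hp0 : ∫ η, M.p0 η ∂M.gibbs = 0 := by
    refine integral_eq_zero_of_flip_odd M.p0.measurable 0 fun η => ?_
    change (flip 0 η 0).2 = -(η 0).2
    simp [flip_apply]
  have e : ∀ η, (M.j01 + M.τ • M.p0) η = -((η 0).2 * deriv M.V (η 1).1) + M.τ * (η 0).2 :=
    fun η => rfl
  have e' : ∀ η, M.p0 η = (η 0).2 := fun η => rfl
  rw [LocalFun.inner_toHilb, semiInner]
  refine finsum_eq_zero_of_forall_eq_zero fun x => ?_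
  rw [corr, hp0, mul_zero, sub_zero]
  simp only [e, e', shift, add_zero]
  by_cases hx : x = 0
  · subst hx
    -- Integration by parts in r_1 of p_0², which does not contain r_1, gives μ(p_0²(V'(r_1) - τ)) =
    -- 0.
    have h := integral_partialR (M := M) (x := 1) (g := fun η => (η 0).2 * (η 0).2)
      (fun η => by simp) ((M.memLp_p_mul_p 0 0).integrable (by norm_num)) (by
        have : partialR 1 (fun η : Config => (η 0).2 * (η 0).2) = fun _ => 0 := by
          funext η; simp [partialR]
        rw [this]
        exact integrable_zero _ _ _)
      ((M.memLp_p_mul_p 0 0).integrable_mul ((M.memLp_deriv_V_two 1).sub (memLp_const M.τ)))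
    have h0 : ∀ η, partialR 1 (fun η : Config => (η 0).2 * (η 0).2) η = 0 := fun η => by
      simp [partialR]
    simp only [h0, integral_zero, mul_zero] at h
    rw [← neg_eq_zero, ← integral_neg, h]
    refine integral_congr_ae (Eventually.of_forall fun η => ?_)
    simp only
    ring
  · refine integral_eq_zero_of_flip_odd ?_ 0 fun η => ?_
    · have := measurable_deriv_V (M := M) 1
      fun_prop
    · simp only [flip_apply, hx, if_true, if_false, one_ne_zero]
      ring

/-! ### The resolvent -/

/-- For l > 0 the default value 0 in the definition of `resolvent` is never taken. -/
lemma solvesResolvent_resolvent (hL : M.GeneratesSemigroup) {l : ℝ} (hl : 0 < l) (g : M.Hilb) :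
    M.SolvesResolvent l g (M.resolvent l g) := by
  have h := existsUnique_solvesResolvent hL hl g
  rw [resolvent, dif_pos h]
  exact h.choose_spec.1

lemma resolvent_p0 (hL : M.GeneratesSemigroup) {l : ℝ} (hl : 0 < l) :
    M.resolvent l M.p0.toHilb = (l + 2 * M.γ)⁻¹ • M.p0.toHilb := by
  have hne : l + 2 * M.γ ≠ 0 := by linarith [M.γ_pos]
  refine (existsUnique_solvesResolvent hL hl M.p0.toHilb).unique
    (solvesResolvent_resolvent hL hl _) ?_
  have h := M.generatorGraph.smul_mem (l + 2 * M.γ)⁻¹ M.p0_mem_generatorGraph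
  rw [Prod.smul_mk, smul_smul] at h
  rw [SolvesResolvent, smul_smul]
  convert h using 2
  nth_rewrite 2 [← one_smul ℝ M.p0.toHilb]
  rw [← sub_smul]
  congr 1
  field_simp
  ring

/-- Pairing the resolvent equation with p_0 and using the adjoint eigenvector identity avoids any
adjoint of the resolvent. -/
lemma inner_p0_resolvent (hL : M.GeneratesSemigroup) {l : ℝ} (hl : 0 < l) (g : M.Hilb) :
    (l + 2 * M.γ) * inner ℝ M.p0.toHilb (M.resolvent l g) = inner ℝ M.p0.toHilb g := by
  have h := inner_p0_of_mem_generatorGraph (solvesResolvent_resolvent hL hl g)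
  simp only [inner_sub_right, inner_smul_right] at h
  linarith

end OscillatorChain

end

/-! ### Vanishing of the off-diagonal coefficients. -/

theorem proposition5p1 (M : OscillatorChain) (hL : M.GeneratesSemigroup) :
    (∀ l : ℝ, 0 < l → ∀ g : M.Hilb, ∃! u : M.Hilb, M.SolvesResolvent l g u) ∧
    Tendsto (fun l : ℝ => inner ℝ (M.j01 + M.τ • M.p0).toHilb (M.resolvent l M.p0.toHilb))
      (𝓝[>] 0) (𝓝 0) ∧
    Tendsto (fun l : ℝ => inner ℝ M.p0.toHilb (M.resolvent l (M.j01 + M.τ • M.p0).toHilb))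
      (𝓝[>] 0) (𝓝 0) ∧
    M.sigma (M.j01 + M.τ • M.p0).toHilb M.p0.toHilb = 0 ∧
    M.sigma M.p0.toHilb (M.j01 + M.τ • M.p0).toHilb = 0 ∧
    M.kappaER = 0 ∧ M.kappaRE = 0 := by
  have t1 : Tendsto (fun l : ℝ => inner ℝ (M.j01 + M.τ • M.p0).toHilb
      (M.resolvent l M.p0.toHilb)) (𝓝[>] 0) (𝓝 0) := by
    -- The function of `l` is identically 0 on l > 0; the same holds for the second limit.
    refine tendsto_const_nhds.congr' ?_
    filter_upwards [self_mem_nhdsWithin] with l hl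
    rw [OscillatorChain.resolvent_p0 hL hl, inner_smul_right, M.inner_current_p0, mul_zero]
  have t2 : Tendsto (fun l : ℝ => inner ℝ M.p0.toHilb
      (M.resolvent l (M.j01 + M.τ • M.p0).toHilb)) (𝓝[>] 0) (𝓝 0) := by
    refine tendsto_const_nhds.congr' ?_
    filter_upwards [self_mem_nhdsWithin] with l hl
    have h := OscillatorChain.inner_p0_resolvent hL hl (M.j01 + M.τ • M.p0).toHilb
    rw [real_inner_comm _ M.p0.toHilb, real_inner_comm _ M.p0.toHilb, M.inner_current_p0] at h
    rw [real_inner_comm]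
    have hpos : 0 < l + 2 * M.γ := add_pos hl (mul_pos two_pos M.γ_pos)
    exact ((mul_eq_zero.1 h).resolve_left hpos.ne').symm
  have s1 : M.sigma (M.j01 + M.τ • M.p0).toHilb M.p0.toHilb = 0 := t1.limUnder_eq
  have s2 : M.sigma M.p0.toHilb (M.j01 + M.τ • M.p0).toHilb = 0 := t2.limUnder_eq
  refine ⟨fun l hl g => OscillatorChain.existsUnique_solvesResolvent hL hl g, t1, t2, s1, s2, ?_, ?_⟩
  · rw [OscillatorChain.kappaER, s2, mul_zero]
  · rw [OscillatorChain.kappaRE, s1, mul_zero]
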